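/- Let $s>-1$, let $J_\nu$ denote the Bessel function of the first kind of order $\nu$, and for $x,y>0$ put $$\mathbb K_{2,s+1}(x,y)=\frac{x^{1/2}J_{s+2}(x^{1/2})J_{s+1}(y^{1/2})-y^{1/2}J_{s+2}(y^{1/2})J_{s+1}(x^{1/2})}{2(x-y)}$$ (extended to the diagonal $x=y$ by continuity), $$K_{1,s}(x,y)=\Bigl(\frac xy\Bigr)^{1/2}\mathbb K_{2,s+1}(x,y)+\frac{J_{s+1}(y^{1/2})}{4y^{1/2}}\int_{x^{1/2}}^\infty J_{s+1}(t)\,dt ,$$ and let the orthogonal Bessel kernel be $$\mathbb K^{Bessel}_{1,s}(x,y)=\begin{bmatrix}K_{1,s}(x,y) & -\int_x^yK_{1,s}(x,t)\,dt-\tfrac12\operatorname{sgn}(x-y)\\[2pt] \frac{\partial}{\partial x}K_{1,s}(x,y)&K_{1,s}(y,x)\end{bmatrix}.$$ Integrals up to $\infty$ are improper integrals, $\int_a^\infty=\lim_{R\to\infty}\int_a^R$. Then $\int_a^\infty J_{s+1}(t)\,dt$ converges for every $a\ge 0$, the integral $\int_0^\infty\det\mathbb K^{Bessel}_{1,s}(x,y)\,dy$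 converges for every $x>0$, and $$\int_0^\infty\Bigl(\int_0^\infty\det\mathbb K^{Bessel}_{1,s}(x,y)\,dy-K_{1,s}(x,x)\Bigr)dx=0,$$ where the outer integral converges as well. -/

import Mathlib

open Filter Topology MeasureTheory

noncomputable section

/-- The Bessel function of the first kind of real order `ν`, for a real argument `x ≥ 0`:
`J_ν(x) = (x/2)^ν ∑_k (-1)^k (x/2)^(2k) / (k! Γ(k+ν+1))`. -/
def besselJ (ν x : ℝ) : ℝ :=
  (x / 2) ^ ν *
    ∑' k : ℕ, (-1) ^ k / ((k.factorial : ℝ) * Real.Gamma (k + ν + 1)) * (x / 2) ^ (2 * k)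

/-- The improper integral `∫_a^∞ f = lim_{b → ∞} ∫_a^b f` exists and equals `L`.
The integrals over the bounded intervals are Lebesgue integrals. -/
def HasImproperIntegral (f : ℝ → ℝ) (a L : ℝ) : Prop :=
  (∀ b : ℝ, a < b → IntegrableOn f (Set.Ioc a b)) ∧
    Tendsto (fun b : ℝ => ∫ t in a..b, f t) atTop (𝓝 L)

/-- The value of the improper integral `∫_a^∞ f = lim_{b → ∞} ∫_a^b f`
(meaningful when that integral converges). -/
def improperIntegral (f : ℝ → ℝ) (a : ℝ) : ℝ :=
  limUnder atTop (fun b : ℝ => ∫ t in a..b, f t)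

/-- `x^{1/2} J_{s+1}(x^{1/2})`, the first factor in the numerator of `besselKernel`. -/
def besselFactor₁ (s x : ℝ) : ℝ := √x * besselJ (s + 1) (√x)

/-- `J_s(x^{1/2})`, the second factor in the numerator of `besselKernel`. -/
def besselFactor₂ (s x : ℝ) : ℝ := besselJ s (√x)

/-- The determinantal Bessel kernel `𝕂_{2,s}` on `(0,∞)`:
`(x^{1/2} J_{s+1}(x^{1/2}) J_s(y^{1/2}) - y^{1/2} J_{s+1}(y^{1/2}) J_s(x^{1/2})) / (2(x-y))`
off the diagonal. On the diagonal it is the limit `y → x` of this quotient, which by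
l'Hôpital's rule is half of `A' B - A B'` at `x`, where `A`, `B` are the two factors above. -/
def besselKernel (s x y : ℝ) : ℝ :=
  if x = y then
    (deriv (besselFactor₁ s) x * besselFactor₂ s x
      - besselFactor₁ s x * deriv (besselFactor₂ s) x) / 2
  else
    (besselFactor₁ s x * besselFactor₂ s y - besselFactor₁ s y * besselFactor₂ s x)
      / (2 * (x - y))

/-- The scalar kernel `K_{1,s}` on `(0,∞)`. -/
def orthogonalBesselScalar (s x y : ℝ) : ℝ :=
  √(x / y) * besselKernel (s + 1) x y
    + besselJ (s + 1) (√y) / (4 * √y) * improperIntegral (besselJ (s + 1)) (√x)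

/-- The orthogonal Bessel kernel `𝕂_{1,s}`, a `2 × 2` matrix kernel on `(0,∞)`. -/
def orthogonalBesselKernel (s x y : ℝ) : Matrix (Fin 2) (Fin 2) ℝ :=
  !![orthogonalBesselScalar s x y,
      -(∫ t in x..y, orthogonalBesselScalar s x t) - 1 / 2 * Real.sign (x - y);
    deriv (fun u : ℝ => orthogonalBesselScalar s u y) x,
      orthogonalBesselScalar s y x]

end

/-!
With `ν = s + 1 > 0`, `J = J_ν`, and the variables `x = r²`, `y = ρ²`, let
`k(r,ρ) = ∫_0^1 u J(ru) J(ρu) du` (`hankelKernel`) and `G(r) = ∫_r^∞ J` (`besselTail`). Then `k/2`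
is the determinantal Bessel kernel, and `K_{1,s}(r²,ρ²) = A(r,ρ) / (2ρ)` with
`A(r,ρ) = r k(r,ρ) + J(ρ) G(r) / 2` (`orthogonalHankelKernel`). The outer integrand vanishes
identically: `∫_0^∞ det 𝕂(x,y) dy = K_{1,s}(x,x)` for every `x > 0`
(`hasImproperIntegral_det`).

By homogeneity of `k` (`hankelKernelEuler_add`), `∂_r A(r,ρ)` is antisymmetric, so that an
integration by parts in `ρ`, with the jump of `sgn` at the diagonal, turns the term with
`∫_x^y K_{1,s}` into a second copy of the term `A(r,ρ) A(ρ,r)` and boundary terms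
(`integral_mul_add_sign_mul`). What remains is `∫_0^∞ A(r,ρ) A(ρ,r) dρ`, which follows from

* `∫_0^∞ ρ k(r,ρ)² dρ = k(r,r)` (`tendsto_integral_mul_sq_hankelKernel`),
* `∫_0^∞ k(r,ρ) G(ρ) dρ = 0` (`tendsto_integral_hankelKernel_mul_besselTail`),
* `∫_0^∞ ρ k(r,ρ) J(ρ) dρ = J(r)/2` (`tendsto_integral_hankelKernel_mul_besselJ`).

For the third, `J(ru)` is expanded in powers of `u`; the moments of
`u ↦ ∫_0^R ρ J(ρu) J(ρ) dρ` on `[0,1]` all have the same limit `c = ∫_0^∞ J_ν J_{ν+1}`, because by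
Lommel's integral two consecutive moments differ by `O(1/R)`. Hence the integral is `c J(r)`.
Differentiation of `σ² k(rσ,ρσ)` in the scale `σ` gives a rank-one function and reduces the first
two integrals to the third, with the values `2c k(r,r)` and `(1/2 - c)(1 - G(r))/r`. The bound
`|k(r,ρ)| ≤ C (rρ)^{-1/2} min(1, 1/|r-ρ|)` shows that the second integral is `o(1/r)` as `r → ∞`,
which forces `c = 1/2`.

Two facts on Bessel functions are needed from the series alone: `J_ν(x) = O(x^{-1/2})`, from an
energy estimate for the system satisfied by `J_ν` and `J_{ν+1}`, and `∫_0^∞ J_ν = 1`, from the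
self-reciprocity of `u^ν e^{-u²/2}` under the Hankel transform.
-/

/-! ### The entire part of the Bessel function and the recurrence relations -/

/-- The coefficients of the entire function `z ↦ ∑ (-1)^k z^k / (k! Γ(k+ν+1))`. -/
noncomputable def besselCoeff (ν : ℝ) (k : ℕ) : ℝ :=
  (-1) ^ k / ((k.factorial : ℝ) * Real.Gamma (k + ν + 1))

/-- The entire function `∑ (-1)^k z^k / (k! Γ(k+ν+1))`, for which
`J_ν(x) = (x/2)^ν besselEntire ν (x²/4)`. -/
noncomputable def besselEntire (ν z : ℝ) : ℝ := ∑' k : ℕ, besselCoeff ν k * z ^ k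

theorem besselJ_eq_rpow_mul_besselEntire (ν x : ℝ) :
    besselJ ν x = (x / 2) ^ ν * besselEntire ν ((x / 2) ^ 2) := by
  unfold besselJ besselEntire besselCoeff
  simp_rw [pow_mul]

theorem Gamma_add_one_mul_factorial_le {ν : ℝ} (hν : 0 < ν) (k : ℕ) :
    Real.Gamma (ν + 1) * (k.factorial : ℝ) ≤ Real.Gamma (k + ν + 1) := by
  have hG : 0 < Real.Gamma (ν + 1) := Real.Gamma_pos_of_pos (by linarith)
  induction k with
  | zero => simp
  | succ k ih =>
    have hk : (0 : ℝ) ≤ k := Nat.cast_nonneg k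
    have h1 : Real.Gamma (((k + 1 : ℕ) : ℝ) + ν + 1)
        = (k + ν + 1) * Real.Gamma (k + ν + 1) := by
      rw [← Real.Gamma_add_one (by positivity)]
      push_cast; ring_nf
    rw [h1, Nat.factorial_succ]
    push_cast
    have h2 : 0 ≤ Real.Gamma (ν + 1) * (k.factorial : ℝ) := by positivity
    calc Real.Gamma (ν + 1) * (((k : ℝ) + 1) * (k.factorial : ℝ))
        = (k + 1) * (Real.Gamma (ν + 1) * (k.factorial : ℝ)) := by ring
      _ ≤ (k + ν + 1) * Real.Gamma (k + ν + 1) :=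
        mul_le_mul (by linarith) ih h2 (by linarith)

theorem abs_besselCoeff (ν : ℝ) (hν : 0 < ν) (k : ℕ) :
    |besselCoeff ν k| = 1 / ((k.factorial : ℝ) * Real.Gamma (k + ν + 1)) := by
  have : 0 < Real.Gamma (k + ν + 1) := Real.Gamma_pos_of_pos (by positivity)
  unfold besselCoeff
  rw [abs_div, abs_pow, abs_neg, abs_one, one_pow, abs_of_pos (by positivity)]

/-- The coefficients decay like `1 / (k!)²`. -/
theorem abs_besselCoeff_le {ν : ℝ} (hν : 0 < ν) (k : ℕ) :
    |besselCoeff ν k| ≤ (Real.Gamma (ν + 1))⁻¹ * ((k.factorial : ℝ)⁻¹ * (k.factorial : ℝ)⁻¹) := by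
  have hG : 0 < Real.Gamma (ν + 1) := Real.Gamma_pos_of_pos (by linarith)
  have hf : (0 : ℝ) < k.factorial := by positivity
  rw [abs_besselCoeff ν hν, one_div, ← mul_inv, ← mul_inv]
  apply inv_anti₀ (by positivity)
  have := mul_le_mul_of_nonneg_left (Gamma_add_one_mul_factorial_le hν k) hf.le
  linarith

theorem besselCoeff_succ_mul {ν : ℝ} (k : ℕ) :
    besselCoeff ν (k + 1) * (k + 1) = -besselCoeff (ν + 1) k := by
  unfold besselCoeff
  have h1 : ((k + 1 : ℕ) : ℝ) + ν + 1 = k + (ν + 1) + 1 := by push_cast; ring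
  have hk : ((k : ℝ) + 1) ≠ 0 := by positivity
  rw [h1, Nat.factorial_succ, pow_succ]
  push_cast
  by_cases hG : Real.Gamma (k + (ν + 1) + 1) = 0
  · rw [hG]; simp
  · field_simp

theorem besselCoeff_eq_mul {ν : ℝ} (hν : 0 < ν) (k : ℕ) :
    besselCoeff ν k = (k + ν + 1) * besselCoeff (ν + 1) k := by
  unfold besselCoeff
  have hp : 0 < (k : ℝ) + ν + 1 := by positivity
  have h1 : (k : ℝ) + (ν + 1) + 1 = (k + ν + 1) + 1 := by ring
  have hG : Real.Gamma (k + ν + 1) ≠ 0 := (Real.Gamma_pos_of_pos hp).ne'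
  rw [h1, Real.Gamma_add_one hp.ne']
  field_simp

theorem summable_abs_besselCoeff_mul {ν : ℝ} (hν : 0 < ν) (z : ℝ) (hz : 0 ≤ z) :
    Summable fun k : ℕ => (k + 1) * |besselCoeff ν k| * z ^ k := by
  have hG : 0 < Real.Gamma (ν + 1) := Real.Gamma_pos_of_pos (by linarith)
  have h := (Real.summable_pow_div_factorial (2 * z)).mul_left (Real.Gamma (ν + 1))⁻¹
  refine h.of_nonneg_of_le (fun k => by positivity) fun k => ?_
  have hf : (1 : ℝ) ≤ k.factorial := by exact_mod_cast Nat.one_le_iff_ne_zero.mpr k.factorial_ne_zero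
  have h2 : ((k : ℝ) + 1) ≤ 2 ^ k := by exact_mod_cast Nat.lt_two_pow_self
  have h3 : (k.factorial : ℝ)⁻¹ * (k.factorial : ℝ)⁻¹ ≤ (k.factorial : ℝ)⁻¹ :=
    mul_le_of_le_one_left (by positivity) (inv_le_one_of_one_le₀ hf)
  calc (k + 1) * |besselCoeff ν k| * z ^ k
      ≤ 2 ^ k * ((Real.Gamma (ν + 1))⁻¹ * (k.factorial : ℝ)⁻¹) * z ^ k := by
        gcongr
        exact (abs_besselCoeff_le hν k).trans (by gcongr)
    _ = _ := by rw [mul_pow]; ring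

theorem summable_besselCoeff {ν : ℝ} (hν : 0 < ν) (z : ℝ) :
    Summable fun k : ℕ => besselCoeff ν k * z ^ k := by
  refine Summable.of_norm_bounded (summable_abs_besselCoeff_mul hν |z| (abs_nonneg z)) fun k => ?_
  rw [norm_mul, norm_pow, Real.norm_eq_abs, Real.norm_eq_abs]
  have : |besselCoeff ν k| ≤ (k + 1) * |besselCoeff ν k| :=
    le_mul_of_one_le_left (abs_nonneg _) (by linarith [Nat.cast_nonneg (α := ℝ) k])
  gcongr

theorem hasDerivAt_besselEntire {ν : ℝ} (hν : 0 < ν) (z : ℝ) :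
    HasDerivAt (besselEntire ν) (-besselEntire (ν + 1) z) z := by
  set M : ℝ := |z| + 1
  have hM : 1 ≤ M := by simp [M]
  have key := hasDerivAt_tsum_of_isPreconnected (𝕜 := ℝ) (F := ℝ)
    (g := fun k w => besselCoeff ν k * w ^ k)
    (g' := fun k w => besselCoeff ν k * (k * w ^ (k - 1)))
    (u := fun k : ℕ => (k + 1) * |besselCoeff ν k| * M ^ k)
    (t := Metric.ball (0 : ℝ) M) (y₀ := z) (y := z)
    (summable_abs_besselCoeff_mul hν M (by linarith)) Metric.isOpen_ball
    (convex_ball 0 M).isPreconnected (fun k w _ => (hasDerivAt_pow k w).const_mul _)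
    (fun k w hw => ?_) (by simp [M]) (summable_besselCoeff hν z) (by simp [M])
  · have h2 : ∑' k : ℕ, besselCoeff ν k * (k * z ^ (k - 1)) = -besselEntire (ν + 1) z := by
      have hs : Summable fun k : ℕ => besselCoeff ν k * (k * z ^ (k - 1)) := by
        rw [← summable_nat_add_iff 1]
        refine (summable_besselCoeff (ν := ν + 1) (by linarith) z).neg.congr fun k => ?_
        have := besselCoeff_succ_mul (ν := ν) k
        simp only [Nat.add_sub_cancel]
        push_cast
        linear_combination (-z ^ k) * this
      rw [hs.tsum_eq_zero_add, besselEntire, ← tsum_neg]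
      simp only [Nat.cast_zero, zero_mul, mul_zero, zero_add]
      refine tsum_congr fun k => ?_
      have := besselCoeff_succ_mul (ν := ν) k
      simp only [Nat.add_sub_cancel]
      push_cast
      linear_combination (z ^ k) * this
    rw [← h2]
    exact key
  · have hw' : |w| ≤ M := by simpa using (Metric.mem_ball.mp hw).le
    rw [norm_mul, norm_mul, norm_pow, Real.norm_eq_abs, Real.norm_eq_abs, Real.norm_eq_abs,
      abs_of_nonneg (Nat.cast_nonneg (α := ℝ) k)]
    have h3 : |w| ^ (k - 1) ≤ M ^ k :=
      (pow_le_pow_left₀ (abs_nonneg w) hw' _).trans (pow_le_pow_right₀ hM (Nat.sub_le k 1))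
    calc |besselCoeff ν k| * (k * |w| ^ (k - 1)) ≤ |besselCoeff ν k| * ((k + 1) * M ^ k) := by
          gcongr; linarith
      _ = _ := by ring

theorem continuous_besselEntire {ν : ℝ} (hν : 0 < ν) : Continuous (besselEntire ν) :=
  continuous_iff_continuousAt.mpr fun z => (hasDerivAt_besselEntire hν z).continuousAt

/-- The contiguous relation `E_ν = (ν+1) E_{ν+1} - z E_{ν+2}` for the entire parts, which is
`J_ν + J_{ν+2} = (2(ν+1)/x) J_{ν+1}`. -/
theorem besselEntire_eq {ν : ℝ} (hν : 0 < ν) (z : ℝ) :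
    besselEntire ν z = (ν + 1) * besselEntire (ν + 1) z - z * besselEntire (ν + 1 + 1) z := by
  have h1 := summable_besselCoeff (ν := ν + 1) (by linarith) z
  have h2 := summable_besselCoeff (ν := ν + 1 + 1) (by linarith) z
  have hk : Summable fun k : ℕ => besselCoeff (ν + 1) k * k * z ^ k := by
    rw [← summable_nat_add_iff 1]
    refine (h2.mul_left (-z)).congr fun k => ?_
    have := besselCoeff_succ_mul (ν := ν + 1) k
    push_cast
    rw [this]; ring
  have h3 : ∑' k : ℕ, besselCoeff (ν + 1) k * k * z ^ k = -z * besselEntire (ν + 1 + 1) z := by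
    rw [hk.tsum_eq_zero_add, besselEntire, ← tsum_mul_left]
    simp only [Nat.cast_zero, zero_mul, mul_zero, zero_add]
    refine tsum_congr fun k => ?_
    have := besselCoeff_succ_mul (ν := ν + 1) k
    push_cast
    rw [this]; ring
  have h4 : besselEntire ν z = (ν + 1) * besselEntire (ν + 1) z
      + ∑' k : ℕ, besselCoeff (ν + 1) k * k * z ^ k := by
    unfold besselEntire
    rw [← tsum_mul_left, ← (h1.mul_left _).tsum_add hk]
    refine tsum_congr fun k => ?_
    rw [besselCoeff_eq_mul hν]; ring
  rw [h4, h3]; ring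

theorem continuous_besselJ {ν : ℝ} (hν : 0 < ν) : Continuous (besselJ ν) := by
  have : besselJ ν = fun x => (x / 2) ^ ν * besselEntire ν ((x / 2) ^ 2) :=
    funext (besselJ_eq_rpow_mul_besselEntire ν)
  rw [this]
  exact ((Real.continuous_rpow_const hν.le).comp (continuous_id.div_const 2)).mul
    ((continuous_besselEntire hν).comp (by fun_prop))

theorem hasDerivAt_besselJ {ν : ℝ} (hν : 0 < ν) {x : ℝ} (hx : 0 < x) :
    HasDerivAt (besselJ ν) (ν / x * besselJ ν x - besselJ (ν + 1) x) x := by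
  have h0 : HasDerivAt (fun x : ℝ => x / 2) (1 / 2) x := (hasDerivAt_id x).div_const 2
  have h1 : HasDerivAt (fun x : ℝ => (x / 2) ^ ν) (1 / 2 * ν * (x / 2) ^ (ν - 1)) x :=
    h0.rpow_const (Or.inl (by positivity))
  have h2 : HasDerivAt (fun x : ℝ => besselEntire ν ((x / 2) ^ 2))
      (-besselEntire (ν + 1) ((x / 2) ^ 2) * (2 * (x / 2) ^ (2 - 1) * (1 / 2))) x := by
    have h := (hasDerivAt_besselEntire hν ((x / 2) ^ 2)).comp x (h0.pow 2)
    refine h.congr_deriv ?_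
    simp
  have h3 := h1.mul h2
  have he : (fun x : ℝ => (x / 2) ^ ν) * (fun x : ℝ => besselEntire ν ((x / 2) ^ 2)) = besselJ ν :=
    funext fun x => (besselJ_eq_rpow_mul_besselEntire ν x).symm
  rw [he] at h3
  refine h3.congr_deriv ?_
  rw [besselJ_eq_rpow_mul_besselEntire, besselJ_eq_rpow_mul_besselEntire,
    Real.rpow_sub_one (by positivity), Real.rpow_add_one (by positivity)]
  field_simp
  ring

/-- The three-term recurrence `J_ν + J_{ν+2} = (2(ν+1)/x) J_{ν+1}`. -/
theorem besselJ_add_besselJ {ν : ℝ} (hν : 0 < ν) {x : ℝ} (hx : 0 < x) :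
    besselJ ν x + besselJ (ν + 1 + 1) x = 2 * (ν + 1) / x * besselJ (ν + 1) x := by
  rw [besselJ_eq_rpow_mul_besselEntire, besselJ_eq_rpow_mul_besselEntire,
    besselJ_eq_rpow_mul_besselEntire, besselEntire_eq hν,
    Real.rpow_add_one (by positivity), Real.rpow_add_one (by positivity)]
  field_simp
  ring

theorem hasDerivAt_besselJ_add_one {ν : ℝ} (hν : 0 < ν) {x : ℝ} (hx : 0 < x) :
    HasDerivAt (besselJ (ν + 1)) (besselJ ν x - (ν + 1) / x * besselJ (ν + 1) x) x := by
  have h := hasDerivAt_besselJ (ν := ν + 1) (by linarith) hx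
  have h2 := besselJ_add_besselJ hν hx
  refine h.congr_deriv ?_
  linear_combination -h2

/-! ### Decay of the Bessel function and its total integral -/

/-- On `(0,∞)` the derivative of `x (J_ν² + J_{ν+1}²) - (2ν+1) J_ν J_{ν+1}` is
`(2ν+1) J_ν J_{ν+1} / x`, which is smaller by a factor `1/x²` than the energy itself;
a Gronwall argument bounds the energy. -/
theorem exists_mul_sq_besselJ_le {ν : ℝ} (hν : 0 < ν) :
    ∃ B, ∀ x, 2 * ν + 1 ≤ x → x * (besselJ ν x) ^ 2 ≤ B := by
  set κ := 2 * ν + 1 with hκ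
  have hκ0 : 0 < κ := by positivity
  let Φ : ℝ → ℝ := fun x => x * (besselJ ν x ^ 2 + besselJ (ν + 1) x ^ 2)
    - κ * (besselJ ν x * besselJ (ν + 1) x)
  let Ψ : ℝ → ℝ := fun x => Φ x * Real.exp (κ * x⁻¹)
  have hΦ : ∀ x, 0 < x → HasDerivAt Φ (κ * (besselJ ν x * besselJ (ν + 1) x) / x) x := by
    intro x hx
    have h1 := hasDerivAt_besselJ hν hx
    have h2 := hasDerivAt_besselJ_add_one hν hx
    have h3 := ((hasDerivAt_id x).mul ((h1.pow 2).add (h2.pow 2))).sub ((h1.mul h2).const_mul κ)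
    refine h3.congr_deriv ?_
    simp only [id, Pi.add_apply, Pi.pow_apply, hκ]
    field_simp
    push_cast
    ring
  have hΨ : ∀ x, 0 < x → HasDerivAt Ψ (κ * (besselJ ν x * besselJ (ν + 1) x) / x
      * Real.exp (κ * x⁻¹) + Φ x * (Real.exp (κ * x⁻¹) * (κ * (-(x ^ 2)⁻¹)))) x := fun x hx =>
    (hΦ x hx).mul (((hasDerivAt_inv hx.ne').const_mul κ).exp)
  have hlow : ∀ x, κ ≤ x → x * (besselJ ν x ^ 2 + besselJ (ν + 1) x ^ 2) ≤ 2 * Φ x := by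
    intro x hx
    have h1 : κ * (2 * (besselJ ν x * besselJ (ν + 1) x))
        ≤ x * (besselJ ν x ^ 2 + besselJ (ν + 1) x ^ 2) :=
      (mul_le_mul_of_nonneg_left (by nlinarith [sq_nonneg (besselJ ν x - besselJ (ν + 1) x)])
        hκ0.le).trans (mul_le_mul_of_nonneg_right hx (by positivity))
    simp only [Φ]
    linarith
  have hanti : AntitoneOn Ψ (Set.Ici κ) := by
    refine antitoneOn_of_deriv_nonpos (convex_Ici κ)
      (fun x hx => (hΨ x (hκ0.trans_le hx)).continuousAt.continuousWithinAt)
      (fun x hx => ?_) (fun x hx => ?_)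
    · rw [interior_Ici] at hx
      exact (hΨ x (hκ0.trans hx)).differentiableAt.differentiableWithinAt
    · rw [interior_Ici] at hx
      have hx0 : 0 < x := hκ0.trans hx
      rw [(hΨ x hx0).deriv]
      have h1 := hlow x hx.le
      have h2 : κ * (besselJ ν x * besselJ (ν + 1) x) / x * Real.exp (κ * x⁻¹)
          + Φ x * (Real.exp (κ * x⁻¹) * (κ * (-(x ^ 2)⁻¹)))
          = Real.exp (κ * x⁻¹) * κ / x ^ 2
            * (x * (besselJ ν x * besselJ (ν + 1) x) - Φ x) := by
        field_simp
        ring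
      rw [h2]
      refine mul_nonpos_of_nonneg_of_nonpos (by positivity) ?_
      have h3 : x * (2 * (besselJ ν x * besselJ (ν + 1) x))
          ≤ x * (besselJ ν x ^ 2 + besselJ (ν + 1) x ^ 2) :=
        mul_le_mul_of_nonneg_left (by nlinarith [sq_nonneg (besselJ ν x - besselJ (ν + 1) x)])
          hx0.le
      linarith
  refine ⟨2 * Ψ κ, fun x hx => ?_⟩
  have hx0 : 0 < x := hκ0.trans_le hx
  have h1 := hlow x hx
  have h2 : 0 ≤ Φ x := by
    have : 0 ≤ x * (besselJ ν x ^ 2 + besselJ (ν + 1) x ^ 2) := by positivity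
    linarith
  have h3 : Φ x ≤ Ψ x :=
    le_mul_of_one_le_right h2 (Real.one_le_exp (by positivity))
  have h4 : Ψ x ≤ Ψ κ := hanti (Set.self_mem_Ici) hx hx
  have h5 : x * besselJ ν x ^ 2 ≤ x * (besselJ ν x ^ 2 + besselJ (ν + 1) x ^ 2) :=
    mul_le_mul_of_nonneg_left (by linarith [sq_nonneg (besselJ (ν + 1) x)]) hx0.le
  linarith

/-- `J_ν(x) = O(x^{-1/2})`, and `J_ν` is bounded on `[0,∞)`. -/
theorem exists_besselJ_bound {ν : ℝ} (hν : 0 < ν) :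
    ∃ C, 0 < C ∧ ∀ x, 0 ≤ x → |besselJ ν x| ≤ C ∧ √x * |besselJ ν x| ≤ C := by
  obtain ⟨B, hB⟩ := exists_mul_sq_besselJ_le hν
  obtain ⟨M, hM⟩ := (isCompact_Icc (a := (0 : ℝ)) (b := 2 * ν + 1)).exists_bound_of_continuousOn
    (continuous_besselJ hν).continuousOn
  have hM0 : 0 ≤ M := (norm_nonneg _).trans (hM 0 ⟨le_rfl, by positivity⟩)
  have hB0 : 0 ≤ √B := Real.sqrt_nonneg B
  have hs0 : 0 ≤ √(2 * ν + 1) := Real.sqrt_nonneg _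
  refine ⟨√B + M + √(2 * ν + 1) * M + 1, by positivity, fun x hx => ?_⟩
  have hp : 0 ≤ √(2 * ν + 1) * M := by positivity
  rcases le_total x (2 * ν + 1) with h | h
  · have h1 : |besselJ ν x| ≤ M := hM x ⟨hx, h⟩
    have h2 : √x * |besselJ ν x| ≤ √(2 * ν + 1) * M :=
      mul_le_mul (Real.sqrt_le_sqrt h) h1 (abs_nonneg _) hs0
    constructor <;> linarith
  · have h1 : √x * |besselJ ν x| ≤ √B := by
      rw [← Real.sqrt_sq_eq_abs, ← Real.sqrt_mul hx]
      exact Real.sqrt_le_sqrt (hB x h)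
    have h2 : 1 ≤ √x := Real.one_le_sqrt.mpr (by linarith)
    have h3 : |besselJ ν x| ≤ √x * |besselJ ν x| := le_mul_of_one_le_left (abs_nonneg _) h2
    constructor <;> linarith

/-- The integrals of `J_ν` beyond `r` are `O(r^{-1/2})`, since `J_ν` differs from the derivative
of `J_{ν+1}` by an absolutely integrable function. -/
theorem exists_abs_integral_besselJ_le {ν : ℝ} (hν : 0 < ν) :
    ∃ C, 0 < C ∧ ∀ r R, 0 < r → r ≤ R → √r * |∫ t in r..R, besselJ ν t| ≤ C := by
  obtain ⟨C, hC, hb⟩ := exists_besselJ_bound (ν := ν + 1) (by linarith)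
  refine ⟨2 * C + (ν + 1) * (2 * C), by positivity, fun r R hr hrR => ?_⟩
  have hR : 0 < R := hr.trans_le hrR
  have hpos : ∀ t ∈ Set.uIcc r R, 0 < t := fun t ht => by
    rw [Set.uIcc_of_le hrR] at ht; exact hr.trans_le ht.1
  have hcJ := continuous_besselJ hν
  have hcJ1 := continuous_besselJ (ν := ν + 1) (by linarith)
  have hcd : ContinuousOn (fun t => (ν + 1) / t * besselJ (ν + 1) t) (Set.uIcc r R) :=
    (continuousOn_const.div continuousOn_id fun t ht => (hpos t ht).ne').mul hcJ1.continuousOn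
  have h1 : ∫ t in r..R, (besselJ ν t - (ν + 1) / t * besselJ (ν + 1) t)
      = besselJ (ν + 1) R - besselJ (ν + 1) r :=
    intervalIntegral.integral_eq_sub_of_hasDerivAt
      (fun t ht => hasDerivAt_besselJ_add_one hν (hpos t ht))
      ((hcJ.continuousOn.sub hcd).intervalIntegrable)
  rw [intervalIntegral.integral_sub (hcJ.intervalIntegrable _ _) hcd.intervalIntegrable] at h1
  have h2 : |∫ t in r..R, (ν + 1) / t * besselJ (ν + 1) t| ≤ (ν + 1) * (2 * C) / √r := by
    have hint : IntervalIntegrable (fun t : ℝ => (ν + 1) * C * t ^ (-(3 / 2) : ℝ)) volume r R :=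
      (continuousOn_const.mul (continuousOn_id.rpow_const
        fun t ht => Or.inl (hpos t ht).ne')).intervalIntegrable
    have h3 := intervalIntegral.norm_integral_le_of_norm_le (μ := volume) hrR
      (f := fun t => (ν + 1) / t * besselJ (ν + 1) t)
      (g := fun t : ℝ => (ν + 1) * C * t ^ (-(3 / 2) : ℝ)) (ae_of_all _ fun t ht => ?_) hint
    · refine h3.trans ?_
      rw [intervalIntegral.integral_const_mul, integral_rpow (Or.inr ⟨by norm_num, fun h =>
        (hpos 0 h).ne rfl⟩)]
      have h4 : (-(3 / 2) : ℝ) + 1 = -(1 / 2) := by norm_num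
      rw [h4, Real.rpow_neg hr.le, Real.rpow_neg hR.le, ← Real.sqrt_eq_rpow, ← Real.sqrt_eq_rpow]
      have h5 : 0 ≤ (√R)⁻¹ := by positivity
      have h6 : 0 ≤ (ν + 1) * C * 2 := by positivity
      have h7 := mul_nonneg h6 h5
      rw [div_eq_mul_inv ((ν + 1) * (2 * C))]
      linarith
    · have ht0 : 0 < t := hr.trans ht.1
      have h4 := (hb t ht0.le).2
      have h5 : t ^ (-(3 / 2) : ℝ) = (t * √t)⁻¹ := by
        rw [Real.rpow_neg ht0.le, Real.sqrt_eq_rpow, ← Real.rpow_one_add' ht0.le (by norm_num)]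
        norm_num
      have hs : 0 < √t := Real.sqrt_pos.mpr ht0
      rw [h5, norm_mul, Real.norm_eq_abs, Real.norm_eq_abs, abs_of_pos (by positivity)]
      calc (ν + 1) / t * |besselJ (ν + 1) t|
          = (ν + 1) * (√t * |besselJ (ν + 1) t|) * (t * √t)⁻¹ := by field_simp
        _ ≤ _ := by gcongr
  have hsr : 0 < √r := Real.sqrt_pos.mpr hr
  have h3 : √r * |besselJ (ν + 1) R| ≤ C :=
    (mul_le_mul_of_nonneg_right (Real.sqrt_le_sqrt hrR) (abs_nonneg _)).trans (hb R hR.le).2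
  have h4 := (hb r hr.le).2
  have h5 : ∫ t in r..R, besselJ ν t = besselJ (ν + 1) R - besselJ (ν + 1) r
      + ∫ t in r..R, (ν + 1) / t * besselJ (ν + 1) t := by linarith
  have h6 : |∫ t in r..R, besselJ ν t| ≤ |besselJ (ν + 1) R| + |besselJ (ν + 1) r|
      + (ν + 1) * (2 * C) / √r := by
    rw [h5]
    exact (abs_add_le _ _).trans (add_le_add (abs_sub _ _) h2)
  calc √r * |∫ t in r..R, besselJ ν t|
      ≤ √r * (|besselJ (ν + 1) R| + |besselJ (ν + 1) r| + (ν + 1) * (2 * C) / √r) := by gcongr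
    _ = √r * |besselJ (ν + 1) R| + √r * |besselJ (ν + 1) r| + (ν + 1) * (2 * C) := by
      field_simp
    _ ≤ _ := by linarith

/-- Integrals over `[r, R]` of size `O(r^{-1/2})` give a convergent improper integral. -/
theorem exists_tendsto_integral_of_tail {f : ℝ → ℝ} (hf : Continuous f) {C : ℝ} (hC : 0 < C)
    (hb : ∀ r R, 1 ≤ r → r ≤ R → √r * |∫ t in r..R, f t| ≤ C) :
    ∃ m, Tendsto (fun R => ∫ t in (0 : ℝ)..R, f t) atTop (𝓝 m) := by
  have hi := fun a b => hf.intervalIntegrable (μ := volume) a b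
  apply cauchySeq_tendsto_of_complete
  rw [Metric.cauchySeq_iff']
  intro ε hε
  have hN : 0 < 2 * C / ε := by positivity
  refine ⟨(2 * C / ε + 1) ^ 2, fun R hR => ?_⟩
  have h1 := hb _ R (one_le_pow₀ (by linarith)) hR
  rw [Real.sqrt_sq (by positivity)] at h1
  rw [Real.dist_eq, intervalIntegral.integral_interval_sub_left (hi _ _) (hi _ _)]
  have h2 : |∫ t in (2 * C / ε + 1) ^ 2..R, f t| ≤ C / (2 * C / ε) := by
    rw [le_div_iff₀ hN]
    nlinarith [abs_nonneg (∫ t in (2 * C / ε + 1) ^ 2..R, f t)]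
  have h3 : C / (2 * C / ε) = ε / 2 := by field_simp
  linarith

theorem exists_abs_integral_le_of_tail {f : ℝ → ℝ} (hf : Continuous f) {C : ℝ} (hC : 0 < C)
    (hb : ∀ r R, 1 ≤ r → r ≤ R → √r * |∫ t in r..R, f t| ≤ C) :
    ∃ D, 0 < D ∧ ∀ R, 0 ≤ R → |∫ t in (0 : ℝ)..R, f t| ≤ D := by
  have hi := fun a b => hf.intervalIntegrable (μ := volume) a b
  have hc : Continuous fun R => ∫ t in (0 : ℝ)..R, f t :=
    intervalIntegral.continuous_primitive (fun a b => hi a b) 0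
  obtain ⟨M, hM⟩ := (isCompact_Icc (a := (0 : ℝ)) (b := 1)).exists_bound_of_continuousOn
    hc.continuousOn
  have hM0 : 0 ≤ M := (norm_nonneg _).trans (hM 0 ⟨le_rfl, by positivity⟩)
  refine ⟨M + C, by positivity, fun R hR => ?_⟩
  rcases le_total R 1 with h | h
  · exact (hM R ⟨hR, h⟩).trans (by linarith)
  · have h1 := hb 1 R le_rfl h
    rw [Real.sqrt_one, one_mul] at h1
    rw [← intervalIntegral.integral_add_adjacent_intervals (hi 0 1) (hi 1 R)]
    exact (abs_add_le _ _).trans (add_le_add (hM 1 ⟨by norm_num, le_rfl⟩) h1)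

theorem exists_abs_integral_zero_besselJ_le {ν : ℝ} (hν : 0 < ν) :
    ∃ C, 0 < C ∧ ∀ R, 0 ≤ R → |∫ t in (0 : ℝ)..R, besselJ ν t| ≤ C := by
  obtain ⟨C, hC, hb⟩ := exists_abs_integral_besselJ_le hν
  exact exists_abs_integral_le_of_tail (continuous_besselJ hν) hC
    fun r R hr hR => hb r R (by linarith) hR

theorem integrableOn_rpow_mul_gaussian {q : ℝ} (hq : -1 < q) :
    IntegrableOn (fun u : ℝ => u ^ q * Real.exp (-(1 / 2) * u ^ 2)) (Set.Ioi 0) :=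
  integrableOn_rpow_mul_exp_neg_mul_sq (by norm_num) hq

/-- The function `u^ν e^{-u²/2}` is its own Hankel transform. -/
theorem integral_gaussian_mul_besselJ {ν : ℝ} (hν : 0 < ν) {r : ℝ} (hr : 0 < r) :
    ∫ u in Set.Ioi (0 : ℝ), u ^ (ν + 1) * Real.exp (-(1 / 2) * u ^ 2) * besselJ ν (r * u)
      = r ^ ν * Real.exp (-(1 / 2) * r ^ 2) := by
  let F : ℕ → ℝ → ℝ := fun k u => besselCoeff ν k * (r / 2) ^ (2 * k + ν)
    * (u ^ (2 * k + 2 * ν + 1) * Real.exp (-(1 / 2) * u ^ 2))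
  have hmom : ∀ k : ℕ, ∫ u in Set.Ioi (0 : ℝ), u ^ (2 * k + 2 * ν + 1)
      * Real.exp (-(1 / 2) * u ^ 2) = 2 ^ (k + ν) * Real.Gamma (k + ν + 1) := by
    intro k
    have h := integral_rpow_mul_exp_neg_mul_rpow (p := 2) (q := 2 * k + 2 * ν + 1) (b := 1 / 2)
      (by norm_num) (by have := Nat.cast_nonneg (α := ℝ) k; linarith) (by norm_num)
    have h2 : (2 * (k : ℝ) + 2 * ν + 1 + 1) / 2 = k + ν + 1 := by ring
    rw [neg_div, h2] at h
    simp only [Real.rpow_two] at h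
    rw [h, one_div, Real.inv_rpow (by norm_num), ← Real.rpow_neg (by norm_num), neg_neg,
      Real.rpow_add_one (by norm_num)]
    ring
  have hint : ∀ k, IntegrableOn (F k) (Set.Ioi 0) := fun k =>
    (integrableOn_rpow_mul_gaussian
      (by have := Nat.cast_nonneg (α := ℝ) k; linarith)).const_mul _
  have hpow : ∀ k : ℕ, (r / 2) ^ (2 * k + ν) * 2 ^ (k + ν) = r ^ ν * (r ^ 2 / 2) ^ k := by
    intro k
    have h2 : (2 : ℝ) ^ ν ≠ 0 := by positivity
    rw [Real.rpow_add (by positivity), Real.rpow_add (by positivity),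
      show (2 * (k : ℝ)) = ((2 * k : ℕ) : ℝ) by push_cast; ring,
      Real.rpow_natCast, Real.rpow_natCast, Real.div_rpow hr.le (by norm_num), div_pow, div_pow,
      pow_mul, pow_mul]
    field_simp
    exact pow_right_comm 2 k 2
  have hFint : ∀ k, ∫ u in Set.Ioi (0 : ℝ), F k u
      = r ^ ν * ((-(1 / 2) * r ^ 2) ^ k / k.factorial) := by
    intro k
    have hG : Real.Gamma (k + ν + 1) ≠ 0 := (Real.Gamma_pos_of_pos (by positivity)).ne'
    simp only [F]
    rw [integral_const_mul, hmom, show besselCoeff ν k * (r / 2) ^ (2 * (k : ℝ) + ν)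
      * (2 ^ (k + ν) * Real.Gamma (k + ν + 1)) = besselCoeff ν k * Real.Gamma (k + ν + 1)
      * ((r / 2) ^ (2 * (k : ℝ) + ν) * 2 ^ (k + ν)) by ring, hpow, besselCoeff,
      show -(1 / 2) * r ^ 2 = -1 * (r ^ 2 / 2) by ring, mul_pow]
    field_simp
  have hFnorm : ∀ k, ∫ u in Set.Ioi (0 : ℝ), ‖F k u‖
      = r ^ ν * ((r ^ 2 / 2) ^ k / k.factorial) := by
    intro k
    have hG : Real.Gamma (k + ν + 1) ≠ 0 := (Real.Gamma_pos_of_pos (by positivity)).ne'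
    have h1 : ∀ u ∈ Set.Ioi (0 : ℝ), ‖F k u‖ = |besselCoeff ν k| * (r / 2) ^ (2 * k + ν)
        * (u ^ (2 * k + 2 * ν + 1) * Real.exp (-(1 / 2) * u ^ 2)) := by
      intro u hu
      have hu0 : (0 : ℝ) < u := hu
      simp only [F]
      rw [norm_mul, norm_mul, Real.norm_eq_abs, Real.norm_of_nonneg (by positivity),
        Real.norm_of_nonneg (by positivity)]
    rw [setIntegral_congr_fun measurableSet_Ioi h1, integral_const_mul, hmom,
      show |besselCoeff ν k| * (r / 2) ^ (2 * (k : ℝ) + ν)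
      * (2 ^ (k + ν) * Real.Gamma (k + ν + 1)) = |besselCoeff ν k| * Real.Gamma (k + ν + 1)
      * ((r / 2) ^ (2 * (k : ℝ) + ν) * 2 ^ (k + ν)) by ring, hpow, abs_besselCoeff ν hν]
    field_simp
  have hsum := hasSum_integral_of_summable_integral_norm (μ := volume.restrict (Set.Ioi (0 : ℝ)))
    (F := F) hint (by
      simp_rw [hFnorm]
      exact (Real.summable_pow_div_factorial _).mul_left _)
  simp_rw [hFint] at hsum
  have hexp : HasSum (fun k : ℕ => r ^ ν * ((-(1 / 2) * r ^ 2) ^ k / k.factorial))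
      (r ^ ν * Real.exp (-(1 / 2) * r ^ 2)) := by
    have h : HasSum (fun k : ℕ => (-(1 / 2) * r ^ 2) ^ k / (k.factorial : ℝ))
        (Real.exp (-(1 / 2) * r ^ 2)) := by
      rw [Real.exp_eq_exp_ℝ]
      exact NormedSpace.expSeries_div_hasSum_exp (𝔸 := ℝ) _
    exact h.mul_left _
  rw [← hsum.unique hexp]
  refine setIntegral_congr_fun measurableSet_Ioi fun u hu => ?_
  have hu0 : (0 : ℝ) < u := hu
  simp only [F]
  rw [besselJ_eq_rpow_mul_besselEntire, besselEntire, ← tsum_mul_left, ← tsum_mul_left]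
  refine tsum_congr fun k => ?_
  have h1 : u ^ (2 * (k : ℝ) + 2 * ν + 1) = u ^ (2 * k) * (u ^ ν * u ^ (ν + 1)) := by
    rw [← Real.rpow_add hu0, ← Real.rpow_natCast, ← Real.rpow_add hu0]
    congr 1; push_cast; ring
  have h2 : (r / 2) ^ (2 * (k : ℝ) + ν) = (r / 2) ^ (2 * k) * (r / 2) ^ ν := by
    rw [← Real.rpow_natCast, ← Real.rpow_add (by positivity)]
    push_cast; rfl
  rw [h1, h2, show r * u / 2 = r / 2 * u by ring, Real.mul_rpow (by positivity) hu0.le,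
    mul_pow (r / 2) u 2, mul_pow, ← pow_mul, ← pow_mul]
  ring

theorem measurable_besselJ {ν : ℝ} (hν : 0 < ν) : Measurable (besselJ ν) :=
  (continuous_besselJ hν).measurable

/-- `∫_0^∞ J_ν = 1`: both sides of the Gaussian self-reciprocity are integrated over `r`; with
`m = ∫_0^∞ J_ν` this gives `m ∫ u^ν e^{-u²/2} du = ∫ r^ν e^{-r²/2} dr`. -/
theorem tendsto_integral_besselJ {ν : ℝ} (hν : 0 < ν) :
    Tendsto (fun R => ∫ t in (0 : ℝ)..R, besselJ ν t) atTop (𝓝 1) := by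
  obtain ⟨A, hA, hbA⟩ := exists_abs_integral_besselJ_le hν
  obtain ⟨m, hm⟩ := exists_tendsto_integral_of_tail (continuous_besselJ hν) hA
    fun r R hr hR => hbA r R (by linarith) hR
  obtain ⟨C, hC, hb⟩ := exists_besselJ_bound hν
  obtain ⟨D, hD, hbD⟩ := exists_abs_integral_zero_besselJ_le hν
  set w : ℝ → ℝ := fun u => u ^ ν * Real.exp (-(1 / 2) * u ^ 2) with hw
  set W : ℝ → ℝ := fun u => u ^ (ν + 1) * Real.exp (-(1 / 2) * u ^ 2) with hW
  have hwi : IntegrableOn w (Set.Ioi 0) := integrableOn_rpow_mul_gaussian (by linarith)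
  have hWi : IntegrableOn W (Set.Ioi 0) := integrableOn_rpow_mul_gaussian (by linarith)
  -- Self-reciprocity of the Gaussian, integrated over `r ∈ [0,R]`.
  have hfin : ∀ R, 0 ≤ R → ∫ r in (0 : ℝ)..R, w r
      = ∫ u in Set.Ioi (0 : ℝ), w u * ∫ t in (0 : ℝ)..R * u, besselJ ν t := by
    intro R hR
    have h1 : ∫ r in (0 : ℝ)..R, w r
        = ∫ r in (0 : ℝ)..R, ∫ u in Set.Ioi (0 : ℝ), W u * besselJ ν (r * u) := by
      refine intervalIntegral.integral_congr_ae (ae_of_all _ fun r hr => ?_)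
      rw [Set.uIoc_of_le hR] at hr
      exact (integral_gaussian_mul_besselJ hν hr.1).symm
    rw [h1, intervalIntegral_integral_swap]
    · refine setIntegral_congr_fun measurableSet_Ioi fun u hu => ?_
      have hu0 : (0 : ℝ) < u := hu
      rw [intervalIntegral.integral_const_mul,
        intervalIntegral.integral_comp_mul_right (besselJ ν) hu0.ne', zero_mul, smul_eq_mul]
      simp only [hw, hW]
      rw [Real.rpow_add_one hu0.ne']
      field_simp
    · have hp : Integrable (fun z : ℝ × ℝ => (fun _ : ℝ => C) z.1 * W z.2)
          ((volume.restrict (Set.uIoc 0 R)).prod (volume.restrict (Set.Ioi 0))) :=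
        Integrable.mul_prod (f := fun _ : ℝ => C) (g := W)
          (by rw [Set.uIoc_of_le hR]; exact integrable_const C) hWi
      refine hp.mono ?_ ?_
      · apply Measurable.aestronglyMeasurable
        have := measurable_besselJ hν
        simp only [Function.uncurry_def, hW]
        fun_prop
      · rw [Measure.prod_restrict]
        filter_upwards [ae_restrict_mem (measurableSet_uIoc.prod measurableSet_Ioi)] with z hz
        rw [Set.uIoc_of_le hR] at hz
        have hz2 : 0 < z.2 := hz.2
        have h2 := (hb (z.1 * z.2) (mul_nonneg hz.1.1.le hz2.le)).1
        simp only [Function.uncurry_def]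
        rw [norm_mul, norm_mul _ (W z.2), mul_comm, Real.norm_of_nonneg hC.le]
        exact mul_le_mul_of_nonneg_right h2 (norm_nonneg _)
  have hl : Tendsto (fun R => ∫ r in (0 : ℝ)..R, w r) atTop (𝓝 (∫ u in Set.Ioi (0 : ℝ), w u)) :=
    intervalIntegral_tendsto_integral_Ioi 0 hwi tendsto_id
  have hc : Continuous fun R => ∫ t in (0 : ℝ)..R, besselJ ν t :=
    intervalIntegral.continuous_primitive
      (fun a b => (continuous_besselJ hν).intervalIntegrable a b) 0
  have hr : Tendsto (fun R : ℝ => ∫ u in Set.Ioi (0 : ℝ), w u * ∫ t in (0 : ℝ)..R * u, besselJ ν t)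
      atTop (𝓝 (∫ u in Set.Ioi (0 : ℝ), w u * m)) := by
    refine tendsto_integral_filter_of_dominated_convergence (fun u => ‖w u‖ * D) ?_ ?_
      (hwi.norm.mul_const D) ?_
    · exact Eventually.of_forall fun R => hwi.aestronglyMeasurable.mul
        (hc.comp (continuous_const.mul continuous_id)).aestronglyMeasurable
    · filter_upwards [eventually_ge_atTop 0] with R hR
      filter_upwards [ae_restrict_mem measurableSet_Ioi] with u hu
      have hu0 : (0 : ℝ) < u := hu
      rw [norm_mul]
      gcongr
      exact hbD _ (by positivity)
    · filter_upwards [ae_restrict_mem measurableSet_Ioi] with u hu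
      exact (hm.comp (tendsto_id.atTop_mul_const hu)).const_mul _
  have heq : ∫ u in Set.Ioi (0 : ℝ), w u = ∫ u in Set.Ioi (0 : ℝ), w u * m := by
    refine tendsto_nhds_unique hl (hr.congr' ?_)
    filter_upwards [eventually_ge_atTop 0] with R hR using (hfin R hR).symm
  have hpos : 0 < ∫ u in Set.Ioi (0 : ℝ), w u := by
    rw [setIntegral_pos_iff_support_of_nonneg_ae _ hwi]
    · have : Function.support w ∩ Set.Ioi 0 = Set.Ioi 0 := by
        refine Set.inter_eq_right.mpr fun u hu => ?_
        have hu0 : (0 : ℝ) < u := hu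
        exact (by positivity : w u ≠ 0)
      rw [this]; simp
    · filter_upwards [ae_restrict_mem measurableSet_Ioi] with u hu
      have hu0 : (0 : ℝ) < u := hu
      exact (by positivity : 0 ≤ w u)
  rw [integral_mul_const] at heq
  have : m = 1 := by
    have h : (∫ u in Set.Ioi (0 : ℝ), w u) * (m - 1) = 0 := by linarith
    rcases mul_eq_zero.mp h with h | h
    · exact absurd h hpos.ne'
    · linarith
  rwa [this] at hm

/-! ### The tail of the Bessel integral and the Hankel kernel -/

/-- The tail `∫_r^∞ J_ν`, written with the help of `∫_0^∞ J_ν = 1`. -/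
noncomputable def besselTail (ν r : ℝ) : ℝ := 1 - ∫ t in (0 : ℝ)..r, besselJ ν t

/-- The kernel `∫_0^1 u J_ν(ru) J_ν(ρu) du`; in the variables `x = r²`, `y = ρ²` it is twice the
determinantal Bessel kernel. -/
noncomputable def hankelKernel (ν r ρ : ℝ) : ℝ :=
  ∫ u in (0 : ℝ)..1, u * besselJ ν (r * u) * besselJ ν (ρ * u)

theorem besselTail_zero (ν : ℝ) : besselTail ν 0 = 1 := by simp [besselTail]

theorem hasDerivAt_besselTail {ν : ℝ} (hν : 0 < ν) (r : ℝ) :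
    HasDerivAt (besselTail ν) (-besselJ ν r) r :=
  ((continuous_besselJ hν).integral_hasStrictDerivAt 0 r).hasDerivAt.const_sub 1

theorem continuous_besselTail {ν : ℝ} (hν : 0 < ν) : Continuous (besselTail ν) :=
  continuous_iff_continuousAt.mpr fun r => (hasDerivAt_besselTail hν r).continuousAt

theorem tendsto_besselTail {ν : ℝ} (hν : 0 < ν) : Tendsto (besselTail ν) atTop (𝓝 0) := by
  have := (tendsto_integral_besselJ hν).const_sub 1
  rwa [sub_self] at this

theorem integral_besselJ_eq {ν : ℝ} (hν : 0 < ν) (a b : ℝ) :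
    ∫ t in a..b, besselJ ν t = besselTail ν a - besselTail ν b := by
  have hi := fun a b => (continuous_besselJ hν).intervalIntegrable (μ := volume) a b
  have := intervalIntegral.integral_interval_sub_left (hi 0 b) (hi 0 a)
  unfold besselTail
  linarith

theorem exists_besselTail_bound {ν : ℝ} (hν : 0 < ν) :
    ∃ C, 0 < C ∧ ∀ r, 0 ≤ r → |besselTail ν r| ≤ C ∧ √r * |besselTail ν r| ≤ C := by
  obtain ⟨C, hC, hb⟩ := exists_abs_integral_besselJ_le hν
  obtain ⟨D, hD, hbD⟩ := exists_abs_integral_zero_besselJ_le hν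
  refine ⟨1 + D + C, by positivity, fun r hr => ⟨?_, ?_⟩⟩
  · have := abs_sub (1 : ℝ) (∫ t in (0 : ℝ)..r, besselJ ν t)
    rw [abs_one] at this
    have := hbD r hr
    unfold besselTail
    linarith
  · rcases hr.eq_or_lt with rfl | hr
    · simp; positivity
    · have h1 : Tendsto (fun R => √r * |besselTail ν r - besselTail ν R|) atTop
          (𝓝 (√r * |besselTail ν r - 0|)) :=
        (((tendsto_besselTail hν).const_sub _).abs).const_mul _
      rw [sub_zero] at h1
      have h2 : √r * |besselTail ν r| ≤ C := by
        refine le_of_tendsto h1 ?_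
        filter_upwards [eventually_ge_atTop r] with R hR
        rw [← integral_besselJ_eq hν]
        exact hb r R hr hR
      linarith

theorem hankelKernel_comm (ν r ρ : ℝ) : hankelKernel ν r ρ = hankelKernel ν ρ r := by
  unfold hankelKernel
  congr 1; ext u; ring

theorem continuous_hankelKernel {ν : ℝ} (hν : 0 < ν) :
    Continuous fun p : ℝ × ℝ => hankelKernel ν p.1 p.2 := by
  have := continuous_besselJ hν
  unfold hankelKernel
  apply intervalIntegral.continuous_parametric_intervalIntegral_of_continuous'
  simp only [Function.uncurry_def]
  fun_prop

theorem hasDerivAt_besselJ_mul {ν : ℝ} (hν : 0 < ν) {r u : ℝ} (hr : 0 < r) (hu : 0 < u) :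
    HasDerivAt (fun u => besselJ ν (r * u))
      (r * (ν / (r * u) * besselJ ν (r * u) - besselJ (ν + 1) (r * u))) u := by
  have h := (hasDerivAt_besselJ hν (mul_pos hr hu)).comp u ((hasDerivAt_id u).const_mul r)
  refine h.congr_deriv ?_
  simp only [mul_one]; ring

theorem hasDerivAt_besselJ_add_one_mul {ν : ℝ} (hν : 0 < ν) {r u : ℝ} (hr : 0 < r) (hu : 0 < u) :
    HasDerivAt (fun u => besselJ (ν + 1) (r * u))
      (r * (besselJ ν (r * u) - (ν + 1) / (r * u) * besselJ (ν + 1) (r * u))) u := by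
  have h := (hasDerivAt_besselJ_add_one hν (mul_pos hr hu)).comp u ((hasDerivAt_id u).const_mul r)
  refine h.congr_deriv ?_
  simp only [mul_one]; ring

/-- Lommel's integral. -/
theorem sq_sub_sq_mul_hankelKernel {ν : ℝ} (hν : 0 < ν) {r ρ : ℝ} (hr : 0 < r) (hρ : 0 < ρ) :
    (r ^ 2 - ρ ^ 2) * hankelKernel ν r ρ
      = r * besselJ (ν + 1) r * besselJ ν ρ - ρ * besselJ (ν + 1) ρ * besselJ ν r := by
  have hc := continuous_besselJ hν
  have hc1 := continuous_besselJ (ν := ν + 1) (by linarith)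
  have h := intervalIntegral.integral_eq_sub_of_hasDerivAt_of_le zero_le_one
    (f := fun u => r * u * besselJ (ν + 1) (r * u) * besselJ ν (ρ * u)
      - ρ * u * besselJ (ν + 1) (ρ * u) * besselJ ν (r * u))
    (f' := fun u => (r ^ 2 - ρ ^ 2) * (u * besselJ ν (r * u) * besselJ ν (ρ * u)))
    (by fun_prop) (fun u hu => ?_) (Continuous.intervalIntegrable (by fun_prop) _ _)
  · rw [intervalIntegral.integral_const_mul] at h
    unfold hankelKernel
    rw [h]; simp
  · have hu0 : 0 < u := hu.1
    have d1 := hasDerivAt_besselJ_mul hν hr hu0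
    have d2 := hasDerivAt_besselJ_mul hν hρ hu0
    have e1 := hasDerivAt_besselJ_add_one_mul hν hr hu0
    have e2 := hasDerivAt_besselJ_add_one_mul hν hρ hu0
    have l1 := (hasDerivAt_id u).const_mul r
    have l2 := (hasDerivAt_id u).const_mul ρ
    refine (((l1.mul e1).mul d2).sub ((l2.mul e2).mul d1)).congr_deriv ?_
    simp only [id, Pi.mul_apply]
    field_simp
    ring

theorem two_mul_sq_mul_hankelKernel_self {ν : ℝ} (hν : 0 < ν) {r : ℝ} (hr : 0 < r) :
    2 * r ^ 2 * hankelKernel ν r r = r ^ 2 * besselJ ν r ^ 2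
      - 2 * ν * r * besselJ ν r * besselJ (ν + 1) r + r ^ 2 * besselJ (ν + 1) r ^ 2 := by
  have hc := continuous_besselJ hν
  have hc1 := continuous_besselJ (ν := ν + 1) (by linarith)
  have h := intervalIntegral.integral_eq_sub_of_hasDerivAt_of_le zero_le_one
    (f := fun u => (r * u) ^ 2 * (besselJ ν (r * u) ^ 2 + besselJ (ν + 1) (r * u) ^ 2)
      - 2 * ν * ((r * u) * (besselJ ν (r * u) * besselJ (ν + 1) (r * u))))
    (f' := fun u => 2 * r ^ 2 * (u * besselJ ν (r * u) * besselJ ν (r * u)))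
    (by fun_prop) (fun u hu => ?_) (Continuous.intervalIntegrable (by fun_prop) _ _)
  · rw [intervalIntegral.integral_const_mul] at h
    unfold hankelKernel
    rw [h]; simp; ring
  · have hu0 : 0 < u := hu.1
    have d1 := hasDerivAt_besselJ_mul hν hr hu0
    have e1 := hasDerivAt_besselJ_add_one_mul hν hr hu0
    have l1 := (hasDerivAt_id u).const_mul r
    refine (((l1.pow 2).mul ((d1.pow 2).add (e1.pow 2))).sub
      ((l1.mul (d1.mul e1)).const_mul (2 * ν))).congr_deriv ?_
    simp only [id, Pi.mul_apply, Pi.pow_apply, Pi.add_apply]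
    field_simp
    push_cast
    ring

/-- The kernel is `O((rρ)^{-1/2})`, with an additional decay `1/|r-ρ|` off the diagonal. -/
theorem exists_hankelKernel_bound {ν : ℝ} (hν : 0 < ν) :
    ∃ C, 0 < C ∧ ∀ r ρ, 0 < r → 0 < ρ → √r * √ρ * |hankelKernel ν r ρ| ≤ C ∧
      √r * √ρ * (|r - ρ| * |hankelKernel ν r ρ|) ≤ C := by
  obtain ⟨C, hC, hb⟩ := exists_besselJ_bound hν
  obtain ⟨C', hC', hb'⟩ := exists_besselJ_bound (ν := ν + 1) (by linarith)
  have hc := continuous_besselJ hν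
  refine ⟨C * C + C' * C, by positivity, fun r ρ hr hρ => ⟨?_, ?_⟩⟩
  · have hs : 0 < √r * √ρ := by positivity
    have h1 : ‖hankelKernel ν r ρ‖ ≤ C * C / (√r * √ρ) * |1 - 0| := by
      refine intervalIntegral.norm_integral_le_of_norm_le_const fun u hu => ?_
      rw [Set.uIoc_of_le zero_le_one] at hu
      have hu0 : 0 < u := hu.1
      have b1 := (hb (r * u) (by positivity)).2
      have b2 := (hb (ρ * u) (by positivity)).2
      rw [Real.sqrt_mul hr.le] at b1
      rw [Real.sqrt_mul hρ.le] at b2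
      rw [le_div_iff₀ hs, norm_mul, norm_mul, Real.norm_of_nonneg hu0.le, Real.norm_eq_abs,
        Real.norm_eq_abs]
      calc u * |besselJ ν (r * u)| * |besselJ ν (ρ * u)| * (√r * √ρ)
          = (√u * √u) * |besselJ ν (r * u)| * |besselJ ν (ρ * u)| * (√r * √ρ) := by
            rw [Real.mul_self_sqrt hu0.le]
        _ = (√r * √u * |besselJ ν (r * u)|) * (√ρ * √u * |besselJ ν (ρ * u)|) := by ring
        _ ≤ C * C := by gcongr
    rw [sub_zero, abs_one, mul_one, Real.norm_eq_abs, le_div_iff₀ hs] at h1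
    nlinarith [mul_pos hC' hC]
  · have h1 := sq_sub_sq_mul_hankelKernel hν hr hρ
    have h2 : (r + ρ) * (|r - ρ| * |hankelKernel ν r ρ|)
        = |r * besselJ (ν + 1) r * besselJ ν ρ - ρ * besselJ (ν + 1) ρ * besselJ ν r| := by
      rw [← h1, abs_mul, show r ^ 2 - ρ ^ 2 = (r + ρ) * (r - ρ) by ring, abs_mul,
        abs_of_pos (by positivity : 0 < r + ρ), mul_assoc]
    have h3 : ∀ a b : ℝ, 0 < a → 0 < b →
        √a * √b * |a * besselJ (ν + 1) a * besselJ ν b| ≤ a * (C' * C) := by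
      intro a b ha hb0
      rw [abs_mul, abs_mul, abs_of_pos ha]
      have b1 := (hb' a ha.le).2
      have b2 := (hb b hb0.le).2
      calc √a * √b * (a * |besselJ (ν + 1) a| * |besselJ ν b|)
          = a * ((√a * |besselJ (ν + 1) a|) * (√b * |besselJ ν b|)) := by ring
        _ ≤ _ := by gcongr
    have h4 := h3 r ρ hr hρ
    have h5 := h3 ρ r hρ hr
    have h6 := abs_sub (r * besselJ (ν + 1) r * besselJ ν ρ) (ρ * besselJ (ν + 1) ρ * besselJ ν r)
    have hs : 0 ≤ √r * √ρ := by positivity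
    have h7 := mul_le_mul_of_nonneg_left h6 hs
    rw [← h2] at h7
    have h8 : (r + ρ) * (√r * √ρ * (|r - ρ| * |hankelKernel ν r ρ|)) ≤ (r + ρ) * (C' * C) := by
      nlinarith
    have h9 := le_of_mul_le_mul_left h8 (by positivity)
    nlinarith [mul_pos hC hC]

/-- The determinantal Bessel kernel in the variables `x = r²`, `y = ρ²`. -/
theorem besselKernel_sq {ν : ℝ} (hν : 0 < ν) {r ρ : ℝ} (hr : 0 < r) (hρ : 0 < ρ) :
    besselKernel ν (r ^ 2) (ρ ^ 2) = hankelKernel ν r ρ / 2 := by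
  unfold besselKernel
  split_ifs with h
  · have hrρ : r = ρ := (pow_left_inj₀ hr.le hρ.le two_ne_zero).mp h
    subst hrρ
    have hsq : √(r ^ 2) = r := Real.sqrt_sq hr.le
    have hs : HasDerivAt Real.sqrt (1 / (2 * r)) (r ^ 2) := by
      have := Real.hasDerivAt_sqrt (x := r ^ 2) (by positivity)
      rwa [hsq] at this
    have d0 : HasDerivAt (besselJ ν) (ν / r * besselJ ν r - besselJ (ν + 1) r) (√(r ^ 2)) := by
      rw [hsq]; exact hasDerivAt_besselJ hν hr
    have d1 : HasDerivAt (besselJ (ν + 1)) (besselJ ν r - (ν + 1) / r * besselJ (ν + 1) r)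
        (√(r ^ 2)) := by
      rw [hsq]; exact hasDerivAt_besselJ_add_one hν hr
    have f2 : HasDerivAt (besselFactor₂ ν) _ (r ^ 2) := d0.comp (r ^ 2) hs
    have f1 : HasDerivAt (besselFactor₁ ν) _ (r ^ 2) := hs.mul (d1.comp (r ^ 2) hs)
    rw [f1.deriv, f2.deriv]
    simp only [besselFactor₁, besselFactor₂, hsq]
    have h2 := two_mul_sq_mul_hankelKernel_self hν hr
    have h3 : hankelKernel ν r r = (r ^ 2 * besselJ ν r ^ 2
      - 2 * ν * r * besselJ ν r * besselJ (ν + 1) r + r ^ 2 * besselJ (ν + 1) r ^ 2)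
        / (2 * r ^ 2) := by
      rw [eq_div_iff (by positivity)]; linarith
    rw [h3]
    field_simp
    ring
  · simp only [besselFactor₁, besselFactor₂, Real.sqrt_sq hr.le, Real.sqrt_sq hρ.le]
    rw [← sq_sub_sq_mul_hankelKernel hν hr hρ]
    have : r ^ 2 - ρ ^ 2 ≠ 0 := sub_ne_zero.mpr h
    field_simp

/-! ### Moments of the truncated Hankel delta function -/

theorem intervalIntegral_swap_of_continuous {F : ℝ → ℝ → ℝ} (hF : Continuous F.uncurry)
    (a b c d : ℝ) :
    ∫ x in a..b, ∫ y in c..d, F x y = ∫ y in c..d, ∫ x in a..b, F x y := by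
  apply intervalIntegral_intervalIntegral_swap
  exact (hF.continuousOn.integrableOn_compact (isCompact_uIcc.prod isCompact_uIcc)).mono_set
    (Set.prod_mono Set.uIoc_subset_uIcc Set.uIoc_subset_uIcc)

theorem Continuous.hankelKernel {X : Type*} [TopologicalSpace X] {ν : ℝ} (hν : 0 < ν)
    {f g : X → ℝ} (hf : Continuous f) (hg : Continuous g) :
    Continuous fun x => _root_.hankelKernel ν (f x) (g x) :=
  (continuous_hankelKernel hν).comp (hf.prodMk hg)

theorem exists_abs_integral_besselJ_mul_besselJ_le {ν : ℝ} (hν : 0 < ν) :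
    ∃ C, 0 < C ∧ ∀ r R, 1 ≤ r → r ≤ R →
      √r * |∫ t in r..R, besselJ ν t * besselJ (ν + 1) t| ≤ C := by
  obtain ⟨C, hC, hb⟩ := exists_besselJ_bound hν
  have hc := continuous_besselJ hν
  have hc1 := continuous_besselJ (ν := ν + 1) (by linarith)
  have hsq : ∀ t, 1 ≤ t → besselJ ν t ^ 2 ≤ C ^ 2 / t := fun t ht => by
    have h := (hb t (by linarith)).2
    rw [le_div_iff₀ (by linarith)]
    calc besselJ ν t ^ 2 * t = (√t * |besselJ ν t|) ^ 2 := by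
          rw [mul_pow, sq_abs, Real.sq_sqrt (by linarith)]; ring
      _ ≤ C ^ 2 := by gcongr
  refine ⟨C ^ 2 + ν * C ^ 2, by positivity, fun r R hr hrR => ?_⟩
  have hpos : ∀ t ∈ Set.uIcc r R, 0 < t := fun t ht => by
    rw [Set.uIcc_of_le hrR] at ht; linarith [ht.1]
  have hcd : ContinuousOn (fun t => ν * besselJ ν t ^ 2 / t) (Set.uIcc r R) :=
    (Continuous.continuousOn (by fun_prop)).div continuousOn_id fun t ht => (hpos t ht).ne'
  have h1 : ∫ t in r..R, (ν * besselJ ν t ^ 2 / t - besselJ ν t * besselJ (ν + 1) t)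
      = besselJ ν R ^ 2 / 2 - besselJ ν r ^ 2 / 2 := by
    refine intervalIntegral.integral_eq_sub_of_hasDerivAt (f := fun t => besselJ ν t ^ 2 / 2)
      (fun t ht => ?_)
      (hcd.sub (Continuous.continuousOn (by fun_prop))).intervalIntegrable
    refine (((hasDerivAt_besselJ hν (hpos t ht)).pow 2).div_const 2).congr_deriv ?_
    push_cast
    ring
  rw [intervalIntegral.integral_sub hcd.intervalIntegrable
    (Continuous.intervalIntegrable (by fun_prop) _ _)] at h1
  have hr0 : 0 < r := by linarith
  have h2 : |∫ t in r..R, ν * besselJ ν t ^ 2 / t| ≤ ν * C ^ 2 / r := by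
    have hint : IntervalIntegrable (fun t : ℝ => ν * C ^ 2 * (t ^ 2)⁻¹) volume r R :=
      (continuousOn_const.mul ((continuousOn_id.pow 2).inv₀
        fun t ht => (pow_pos (hpos t ht) 2).ne')).intervalIntegrable
    have h3 := intervalIntegral.norm_integral_le_of_norm_le (μ := volume) hrR
      (f := fun t => ν * besselJ ν t ^ 2 / t)
      (g := fun t : ℝ => ν * C ^ 2 * (t ^ 2)⁻¹) (ae_of_all _ fun t ht => ?_) hint
    · have h4 : ∫ t in r..R, (t ^ 2)⁻¹ = r⁻¹ - R⁻¹ := by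
        have := intervalIntegral.integral_eq_sub_of_hasDerivAt (a := r) (b := R)
          (f := fun t : ℝ => -t⁻¹) (f' := fun t => (t ^ 2)⁻¹)
          (fun t ht => ((hasDerivAt_inv (hpos t ht).ne').neg).congr_deriv (by simp))
          ((continuousOn_id.pow 2).inv₀ fun t ht => (pow_pos (hpos t ht) 2).ne').intervalIntegrable
        rw [this]; ring
      rw [intervalIntegral.integral_const_mul, h4] at h3
      refine h3.trans ?_
      have h5 : 0 ≤ R⁻¹ := inv_nonneg.mpr (by linarith)
      rw [div_eq_mul_inv]
      have : 0 ≤ ν * C ^ 2 := by positivity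
      nlinarith
    · have ht0 : 0 < t := hr0.trans ht.1
      rw [Real.norm_of_nonneg (by positivity)]
      calc ν * besselJ ν t ^ 2 / t ≤ ν * (C ^ 2 / t) / t := by
            gcongr; exact hsq t (by linarith [ht.1])
        _ = _ := by field_simp
  have h3 : |∫ t in r..R, besselJ ν t * besselJ (ν + 1) t| ≤ (C ^ 2 + ν * C ^ 2) / r := by
    have h4 := hsq r hr
    have h5 := (hsq R (by linarith)).trans (div_le_div_of_nonneg_left (by positivity) hr0 hrR)
    have h6 := sq_nonneg (besselJ ν r)
    have h7 := sq_nonneg (besselJ ν R)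
    rw [add_div]
    rw [abs_le] at h2 ⊢
    have h8 : 0 ≤ C ^ 2 / r := by positivity
    constructor <;> linarith [h2.1, h2.2]
  have hsr : √r ≤ r := by
    rw [Real.sqrt_le_left hr0.le]; nlinarith
  calc √r * |∫ t in r..R, besselJ ν t * besselJ (ν + 1) t|
      ≤ r * ((C ^ 2 + ν * C ^ 2) / r) := by gcongr
    _ = _ := by field_simp

/-- `J_μ` integrates against `u^{μ+1} u^j` with a gain of `R^{-3/2}`. -/
theorem exists_abs_integral_pow_mul_besselJ_le {μ : ℝ} (hμ : 0 < μ) :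
    ∃ C, 0 < C ∧ ∀ (j : ℕ) (R : ℝ), 0 < R →
      √R * |R * ∫ u in (0 : ℝ)..1, u ^ j * (u ^ (μ + 1) * besselJ μ (R * u))| ≤ C * (1 + j) := by
  obtain ⟨C, hC, hb⟩ := exists_besselJ_bound (ν := μ + 1) (by linarith)
  have hc := continuous_besselJ hμ
  have hc1 := continuous_besselJ (ν := μ + 1) (by linarith)
  have hcr : Continuous fun u : ℝ => u ^ (μ + 1) := Real.continuous_rpow_const (by linarith)
  refine ⟨C, hC, fun j R hR => ?_⟩
  have h := intervalIntegral.integral_eq_sub_of_hasDerivAt_of_le zero_le_one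
    (f := fun u => u ^ j * (u ^ (μ + 1) * besselJ (μ + 1) (R * u)))
    (f' := fun u => j * u ^ (j - 1) * (u ^ (μ + 1) * besselJ (μ + 1) (R * u))
      + R * (u ^ j * (u ^ (μ + 1) * besselJ μ (R * u))))
    (by fun_prop) (fun u hu => ?_) (Continuous.intervalIntegrable (by fun_prop) _ _)
  · rw [intervalIntegral.integral_add (Continuous.intervalIntegrable (by fun_prop) _ _)
      (Continuous.intervalIntegrable (by fun_prop) _ _), intervalIntegral.integral_const_mul] at h
    simp only [one_pow, Real.one_rpow, one_mul, mul_one, Real.zero_rpow (by linarith : μ + 1 ≠ 0),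
      zero_mul, mul_zero, sub_zero] at h
    have hs : 0 < √R := Real.sqrt_pos.mpr hR
    have h1 : ‖∫ u in (0 : ℝ)..1, j * u ^ (j - 1) * (u ^ (μ + 1) * besselJ (μ + 1) (R * u))‖
        ≤ j * C / √R * |1 - 0| := by
      refine intervalIntegral.norm_integral_le_of_norm_le_const fun u hu => ?_
      rw [Set.uIoc_of_le zero_le_one] at hu
      have hu0 : 0 < u := hu.1
      have b1 := (hb (R * u) (by positivity)).2
      rw [Real.sqrt_mul hR.le] at b1
      have h2 : u ^ (μ + 1) ≤ √u := by
        rw [Real.sqrt_eq_rpow]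
        exact Real.rpow_le_rpow_of_exponent_ge hu0 hu.2 (by linarith)
      have h3 : u ^ (j - 1) ≤ 1 := pow_le_one₀ hu0.le hu.2
      rw [le_div_iff₀ hs, norm_mul, norm_mul (u ^ (μ + 1)), Real.norm_of_nonneg (by positivity),
        Real.norm_of_nonneg (by positivity), Real.norm_eq_abs]
      calc j * u ^ (j - 1) * (u ^ (μ + 1) * |besselJ (μ + 1) (R * u)|) * √R
          ≤ j * 1 * (√u * |besselJ (μ + 1) (R * u)|) * √R := by gcongr
        _ = j * (√R * √u * |besselJ (μ + 1) (R * u)|) := by ring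
        _ ≤ j * C := by gcongr
    rw [sub_zero, abs_one, mul_one, Real.norm_eq_abs, le_div_iff₀ hs] at h1
    have h2 := (hb R hR.le).2
    have h3 : R * ∫ u in (0 : ℝ)..1, u ^ j * (u ^ (μ + 1) * besselJ μ (R * u))
        = besselJ (μ + 1) R
          - ∫ u in (0 : ℝ)..1, j * u ^ (j - 1) * (u ^ (μ + 1) * besselJ (μ + 1) (R * u)) := by
      linarith
    rw [h3]
    have h4 := mul_le_mul_of_nonneg_left (abs_sub (besselJ (μ + 1) R)
      (∫ u in (0 : ℝ)..1, j * u ^ (j - 1) * (u ^ (μ + 1) * besselJ (μ + 1) (R * u)))) hs.le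
    linarith
  · have hu0 : 0 < u := hu.1
    have d := (hasDerivAt_pow j u).mul
      ((Real.hasDerivAt_rpow_const (p := μ + 1) (Or.inl hu0.ne')).mul
        (hasDerivAt_besselJ_add_one_mul hμ hR hu0))
    refine d.congr_deriv ?_
    simp only [Pi.mul_apply]
    rw [add_sub_cancel_right, Real.rpow_add_one hu0.ne']
    field_simp
    ring

/-- The moments of the truncated Hankel delta function
`∫_0^R ρ J_ν(ρu) J_ν(ρ) dρ = R² hankelKernel R (Ru)` on `[0,1]`. -/
noncomputable def hankelMoment (ν : ℝ) (k : ℕ) (R : ℝ) : ℝ :=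
  ∫ u in (0 : ℝ)..1, u ^ (2 * k) * (u ^ (ν + 1) * (R ^ 2 * hankelKernel ν R (R * u)))

/-- The kernel after a rescaling of the variable of integration. -/
theorem sq_mul_hankelKernel_mul (ν a b R : ℝ) :
    R ^ 2 * hankelKernel ν (a * R) (b * R)
      = ∫ ρ in (0 : ℝ)..R, ρ * besselJ ν (a * ρ) * besselJ ν (b * ρ) := by
  have h := intervalIntegral.mul_integral_comp_mul_left (a := 0) (b := 1)
    (f := fun ρ => ρ * besselJ ν (a * ρ) * besselJ ν (b * ρ)) R
  rw [mul_zero, mul_one] at h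
  rw [← h, hankelKernel, ← intervalIntegral.integral_const_mul,
    ← intervalIntegral.integral_const_mul]
  congr 1; ext u
  rw [mul_assoc a R u, mul_assoc b R u]
  ring

theorem hankelMoment_zero {ν : ℝ} (hν : 0 < ν) {R : ℝ} (hR : 0 ≤ R) :
    hankelMoment ν 0 R = ∫ ρ in (0 : ℝ)..R, besselJ ν ρ * besselJ (ν + 1) ρ := by
  have hc := continuous_besselJ hν
  have hc1 := continuous_besselJ (ν := ν + 1) (by linarith)
  have hcr : Continuous fun u : ℝ => u ^ (ν + 1) := Real.continuous_rpow_const (by linarith)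
  have h1 : hankelMoment ν 0 R = ∫ u in (0 : ℝ)..1, ∫ ρ in (0 : ℝ)..R,
      ρ * besselJ ν ρ * (u ^ (ν + 1) * besselJ ν (ρ * u)) := by
    unfold hankelMoment
    congr 1; ext u
    have := sq_mul_hankelKernel_mul ν 1 u R
    rw [one_mul, mul_comm u R] at this
    rw [this, mul_zero, pow_zero, one_mul, ← intervalIntegral.integral_const_mul]
    congr 1; ext ρ
    rw [one_mul, mul_comm u ρ]; ring
  rw [h1, intervalIntegral_swap_of_continuous (by simp only [Function.uncurry_def]; fun_prop)]
  refine intervalIntegral.integral_congr_ae (ae_of_all _ fun ρ hρ => ?_)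
  rw [Set.uIoc_of_le hR] at hρ
  have hρ0 : 0 < ρ := hρ.1
  rw [intervalIntegral.integral_const_mul]
  have h := intervalIntegral.integral_eq_sub_of_hasDerivAt_of_le zero_le_one
    (f := fun u => u ^ (ν + 1) * besselJ (ν + 1) (ρ * u))
    (f' := fun u => ρ * (u ^ (ν + 1) * besselJ ν (ρ * u)))
    (by fun_prop) (fun u hu => ?_) (Continuous.intervalIntegrable (by fun_prop) _ _)
  · rw [intervalIntegral.integral_const_mul] at h
    simp only [Real.one_rpow, one_mul, mul_one, Real.zero_rpow (by linarith : ν + 1 ≠ 0),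
      zero_mul, sub_zero] at h
    rw [← h]; ring
  · have hu0 : 0 < u := hu.1
    have d := (Real.hasDerivAt_rpow_const (p := ν + 1) (Or.inl hu0.ne')).mul
        (hasDerivAt_besselJ_add_one_mul hν hρ0 hu0)
    refine d.congr_deriv ?_
    rw [add_sub_cancel_right, Real.rpow_add_one hu0.ne']
    field_simp
    ring

/-- The difference of two moments carries the factor `1 - u²`, which cancels the denominator in
Lommel's integral. -/
theorem hankelMoment_sub_succ {ν : ℝ} (hν : 0 < ν) (k : ℕ) {R : ℝ} (hR : 0 < R) :
    hankelMoment ν k R - hankelMoment ν (k + 1) R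
      = R * besselJ (ν + 1) R * (∫ u in (0 : ℝ)..1, u ^ (2 * k) * (u ^ (ν + 1) * besselJ ν (R * u)))
        - R * besselJ ν R *
          ∫ u in (0 : ℝ)..1, u ^ (2 * k) * (u ^ (ν + 1 + 1) * besselJ (ν + 1) (R * u)) := by
  have hc := continuous_besselJ hν
  have hc1 := continuous_besselJ (ν := ν + 1) (by linarith)
  have hcr : Continuous fun u : ℝ => u ^ (ν + 1) := Real.continuous_rpow_const (by linarith)
  have hcr1 : Continuous fun u : ℝ => u ^ (ν + 1 + 1) := Real.continuous_rpow_const (by linarith)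
  have hcK : Continuous fun u : ℝ => hankelKernel ν R (R * u) :=
    Continuous.hankelKernel hν (by fun_prop) (by fun_prop)
  unfold hankelMoment
  rw [← intervalIntegral.integral_sub (Continuous.intervalIntegrable (by fun_prop) _ _)
    (Continuous.intervalIntegrable (by fun_prop) _ _), ← intervalIntegral.integral_const_mul,
    ← intervalIntegral.integral_const_mul,
    ← intervalIntegral.integral_sub (Continuous.intervalIntegrable (by fun_prop) _ _)
    (Continuous.intervalIntegrable (by fun_prop) _ _)]
  refine intervalIntegral.integral_congr_ae (ae_of_all _ fun u hu => ?_)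
  rw [Set.uIoc_of_le zero_le_one] at hu
  have hu0 : 0 < u := hu.1
  have h := sq_sub_sq_mul_hankelKernel hν hR (mul_pos hR hu0)
  rw [Real.rpow_add_one hu0.ne' (ν + 1), mul_add 2 k 1, pow_add]
  linear_combination (u ^ (2 * k) * u ^ (ν + 1)) * h

/-- Consecutive moments differ by `O(1/R)`, and by a bound independent of the order. -/
theorem exists_abs_hankelMoment_sub_le {ν : ℝ} (hν : 0 < ν) :
    ∃ C, 0 < C ∧ ∀ (k : ℕ) (R : ℝ), 0 < R →
      |hankelMoment ν k R - hankelMoment ν (k + 1) R| ≤ C ∧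
      R * |hankelMoment ν k R - hankelMoment ν (k + 1) R| ≤ C * (1 + (2 * k : ℕ)) := by
  obtain ⟨A, hA, hbA⟩ := exists_besselJ_bound hν
  obtain ⟨A', hA', hbA'⟩ := exists_besselJ_bound (ν := ν + 1) (by linarith)
  obtain ⟨B, hB, hbB⟩ := exists_abs_integral_pow_mul_besselJ_le hν
  obtain ⟨B', hB', hbB'⟩ := exists_abs_integral_pow_mul_besselJ_le (μ := ν + 1) (by linarith)
  refine ⟨2 * (A' * A) + (A' * B + A * B'), by positivity, fun k R hR => ?_⟩
  have hs : 0 < √R := Real.sqrt_pos.mpr hR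
  have hss : √R * √R = R := Real.mul_self_sqrt hR.le
  have h1 := (hbA R hR.le).2
  have h1' := (hbA' R hR.le).2
  rw [hankelMoment_sub_succ hν k hR]
  set I := ∫ u in (0 : ℝ)..1, u ^ (2 * k) * (u ^ (ν + 1) * besselJ ν (R * u)) with hI
  set I' := ∫ u in (0 : ℝ)..1, u ^ (2 * k) * (u ^ (ν + 1 + 1) * besselJ (ν + 1) (R * u)) with hI'
  have gen : ∀ (μ D : ℝ), 0 < μ → (∀ x, 0 ≤ x → |besselJ μ x| ≤ D ∧ √x * |besselJ μ x| ≤ D) →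
      √R * |∫ u in (0 : ℝ)..1, u ^ (2 * k) * (u ^ (μ + 1) * besselJ μ (R * u))| ≤ D := by
    intro μ D hμ hD
    have h2 : ‖∫ u in (0 : ℝ)..1, u ^ (2 * k) * (u ^ (μ + 1) * besselJ μ (R * u))‖
        ≤ D / √R * |1 - 0| := by
      refine intervalIntegral.norm_integral_le_of_norm_le_const fun u hu => ?_
      rw [Set.uIoc_of_le zero_le_one] at hu
      have hu0 : 0 < u := hu.1
      have b1 := (hD (R * u) (by positivity)).2
      rw [Real.sqrt_mul hR.le] at b1
      have h2 : u ^ (μ + 1) ≤ √u := by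
        rw [Real.sqrt_eq_rpow]
        exact Real.rpow_le_rpow_of_exponent_ge hu0 hu.2 (by linarith)
      have h3 : u ^ (2 * k) ≤ 1 := pow_le_one₀ hu0.le hu.2
      rw [le_div_iff₀ hs, norm_mul, norm_mul, Real.norm_of_nonneg (by positivity),
        Real.norm_of_nonneg (by positivity), Real.norm_eq_abs]
      calc u ^ (2 * k) * (u ^ (μ + 1) * |besselJ μ (R * u)|) * √R
          ≤ 1 * (√u * |besselJ μ (R * u)|) * √R := by gcongr
        _ = √R * √u * |besselJ μ (R * u)| := by ring
        _ ≤ D := b1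
    rw [sub_zero, abs_one, mul_one, Real.norm_eq_abs, le_div_iff₀ hs] at h2
    linarith
  have g := gen ν A hν hbA
  have g' := gen (ν + 1) A' (by linarith) hbA'
  rw [← hI] at g
  rw [← hI'] at g'
  have e := hbB (2 * k) R hR
  have e' := hbB' (2 * k) R hR
  rw [← hI] at e
  rw [← hI'] at e'
  have habs := abs_sub (R * besselJ (ν + 1) R * I) (R * besselJ ν R * I')
  have p0 : 0 < A' * B + A * B' := by positivity
  constructor
  · have q1 : |R * besselJ (ν + 1) R * I| ≤ A' * A := by
      rw [abs_mul, abs_mul, abs_of_pos hR]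
      calc R * |besselJ (ν + 1) R| * |I| = (√R * √R) * |besselJ (ν + 1) R| * |I| := by rw [hss]
        _ = (√R * |besselJ (ν + 1) R|) * (√R * |I|) := by ring
        _ ≤ _ := by gcongr
    have q2 : |R * besselJ ν R * I'| ≤ A * A' := by
      rw [abs_mul, abs_mul, abs_of_pos hR]
      calc R * |besselJ ν R| * |I'| = (√R * √R) * |besselJ ν R| * |I'| := by rw [hss]
        _ = (√R * |besselJ ν R|) * (√R * |I'|) := by ring
        _ ≤ _ := by gcongr
    linarith
  · have hk : (0 : ℝ) ≤ (2 * k : ℕ) := Nat.cast_nonneg _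
    rw [abs_mul, abs_of_pos hR] at e e'
    have q1 : R * |R * besselJ (ν + 1) R * I| ≤ A' * (B * (1 + (2 * k : ℕ))) := by
      rw [abs_mul, abs_mul, abs_of_pos hR]
      calc R * (R * |besselJ (ν + 1) R| * |I|)
          = (√R * √R) * (R * |besselJ (ν + 1) R| * |I|) := by rw [hss]
        _ = (√R * |besselJ (ν + 1) R|) * (√R * (R * |I|)) := by ring
        _ ≤ _ := by gcongr
    have q2 : R * |R * besselJ ν R * I'| ≤ A * (B' * (1 + (2 * k : ℕ))) := by
      rw [abs_mul, abs_mul, abs_of_pos hR]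
      calc R * (R * |besselJ ν R| * |I'|)
          = (√R * √R) * (R * |besselJ ν R| * |I'|) := by rw [hss]
        _ = (√R * |besselJ ν R|) * (√R * (R * |I'|)) := by ring
        _ ≤ _ := by gcongr
    have q3 := mul_le_mul_of_nonneg_left habs hR.le
    have q4 : 0 ≤ 2 * (A' * A) * (1 + ((2 * k : ℕ) : ℝ)) := by positivity
    nlinarith

/-! ### The projection of the Bessel function, and reduction by scaling -/

/-- The truncated projection `∫_0^R ρ k(r,ρ) J_ν(ρ) dρ` of `J_ν`, where `k` is `hankelKernel`. -/
noncomputable def hankelProjection (ν R r : ℝ) : ℝ :=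
  ∫ ρ in (0 : ℝ)..R, ρ * hankelKernel ν r ρ * besselJ ν ρ

theorem hankelProjection_eq {ν : ℝ} (hν : 0 < ν) (R r : ℝ) :
    hankelProjection ν R r
      = ∫ u in (0 : ℝ)..1, u * besselJ ν (r * u) * (R ^ 2 * hankelKernel ν R (R * u)) := by
  have hc := continuous_besselJ hν
  have h1 : hankelProjection ν R r = ∫ ρ in (0 : ℝ)..R, ∫ u in (0 : ℝ)..1,
      u * besselJ ν (r * u) * (ρ * besselJ ν ρ * besselJ ν (u * ρ)) := by
    unfold hankelProjection
    congr 1; ext ρ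
    rw [hankelKernel, ← intervalIntegral.integral_const_mul, ← intervalIntegral.integral_mul_const]
    congr 1; ext u
    rw [mul_comm ρ u]; ring
  rw [h1, intervalIntegral_swap_of_continuous (by simp only [Function.uncurry_def]; fun_prop)]
  congr 1; ext u
  have := sq_mul_hankelKernel_mul ν 1 u R
  rw [one_mul, mul_comm u R] at this
  rw [this, intervalIntegral.integral_const_mul]
  simp only [one_mul]

/-- Expansion of `J_ν(ru)` in powers of `u` under the integral in `hankelProjection_eq`. -/
theorem hasSum_hankelProjection {ν : ℝ} (hν : 0 < ν) (R : ℝ) {r : ℝ} (hr : 0 ≤ r) :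
    HasSum (fun k : ℕ => besselCoeff ν k * ((r / 2) ^ 2) ^ k * (r / 2) ^ ν * hankelMoment ν k R)
      (hankelProjection ν R r) := by
  have hcr : Continuous fun u : ℝ => u ^ (ν + 1) := Real.continuous_rpow_const (by linarith)
  have hcK : Continuous fun u : ℝ => hankelKernel ν R (R * u) :=
    Continuous.hankelKernel hν (by fun_prop) (by fun_prop)
  obtain ⟨M, hM⟩ := (isCompact_Icc (a := (0 : ℝ)) (b := 1)).exists_bound_of_continuousOn
    (f := fun u => u ^ (ν + 1) * (R ^ 2 * hankelKernel ν R (R * u)))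
    (Continuous.continuousOn (by fun_prop))
  have hr2 : 0 ≤ (r / 2) ^ ν := by positivity
  let F : ℕ → ℝ → ℝ := fun k u => besselCoeff ν k * ((r / 2) ^ 2) ^ k * (r / 2) ^ ν
    * (u ^ (2 * k) * (u ^ (ν + 1) * (R ^ 2 * hankelKernel ν R (R * u))))
  have hFc : ∀ k, Continuous (F k) := fun k => by simp only [F]; fun_prop
  have hint : ∀ k, IntegrableOn (F k) (Set.Ioc 0 1) := fun k =>
    ((hFc k).intervalIntegrable 0 1).1
  have hnorm : ∀ k, ∫ u in Set.Ioc (0 : ℝ) 1, ‖F k u‖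
      ≤ |besselCoeff ν k| * ((r / 2) ^ 2) ^ k * (r / 2) ^ ν * M := by
    intro k
    have h1 : ∫ u in Set.Ioc (0 : ℝ) 1, ‖F k u‖ ≤ ∫ u in Set.Ioc (0 : ℝ) 1,
        |besselCoeff ν k| * ((r / 2) ^ 2) ^ k * (r / 2) ^ ν * M := by
      refine setIntegral_mono_on (hint k).norm (integrable_const _) measurableSet_Ioc
        fun u hu => ?_
      have h2 := hM u ⟨hu.1.le, hu.2⟩
      have h3 : ‖u ^ (2 * k)‖ ≤ 1 := by
        rw [norm_pow, Real.norm_of_nonneg hu.1.le]; exact pow_le_one₀ hu.1.le hu.2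
      simp only [F]
      rw [norm_mul, norm_mul (u ^ (2 * k)), norm_mul, norm_mul, Real.norm_of_nonneg hr2,
        Real.norm_of_nonneg (by positivity : 0 ≤ ((r / 2) ^ 2) ^ k), Real.norm_eq_abs]
      refine mul_le_mul_of_nonneg_left ?_ (by positivity)
      exact (mul_le_of_le_one_left (norm_nonneg _) h3).trans h2
    simpa using h1
  have hsum := hasSum_integral_of_summable_integral_norm
    (μ := volume.restrict (Set.Ioc (0 : ℝ) 1)) (F := F) hint (by
      refine Summable.of_nonneg_of_le (fun k => integral_nonneg fun u => norm_nonneg _) hnorm ?_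
      refine ((summable_besselCoeff hν ((r / 2) ^ 2)).abs.congr fun k => ?_).mul_right _
        |>.mul_right _
      rw [abs_mul, abs_of_nonneg (by positivity : 0 ≤ ((r / 2) ^ 2) ^ k)])
  have h1 : ∀ k, ∫ u in Set.Ioc (0 : ℝ) 1, F k u
      = besselCoeff ν k * ((r / 2) ^ 2) ^ k * (r / 2) ^ ν * hankelMoment ν k R := by
    intro k
    simp only [F]
    rw [integral_const_mul, hankelMoment, intervalIntegral.integral_of_le zero_le_one]
  simp_rw [h1] at hsum
  suffices h : hankelProjection ν R r = ∫ u in Set.Ioc (0 : ℝ) 1, ∑' k, F k u by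
    rw [h]; exact hsum
  rw [hankelProjection_eq hν, intervalIntegral.integral_of_le zero_le_one]
  refine setIntegral_congr_fun measurableSet_Ioc fun u hu => ?_
  have hu0 : 0 < u := hu.1
  simp only [F]
  rw [besselJ_eq_rpow_mul_besselEntire, besselEntire, ← tsum_mul_left, ← tsum_mul_left,
    ← tsum_mul_right]
  refine tsum_congr fun k => ?_
  rw [show r * u / 2 = r / 2 * u by ring, Real.mul_rpow (by positivity) hu0.le,
    mul_pow (r / 2) u 2, mul_pow, Real.rpow_add_one hu0.ne', ← pow_mul, ← pow_mul]
  ring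

theorem tendsto_hankelMoment {ν c : ℝ} (hν : 0 < ν)
    (hc : Tendsto (fun R => ∫ t in (0 : ℝ)..R, besselJ ν t * besselJ (ν + 1) t) atTop (𝓝 c))
    (k : ℕ) : Tendsto (hankelMoment ν k) atTop (𝓝 c) := by
  obtain ⟨C, hC, hb⟩ := exists_abs_hankelMoment_sub_le hν
  induction k with
  | zero =>
    refine hc.congr' ?_
    filter_upwards [eventually_ge_atTop 0] with R hR using (hankelMoment_zero hν hR).symm
  | succ k ih =>
    have h1 : Tendsto (fun R => hankelMoment ν k R - hankelMoment ν (k + 1) R) atTop (𝓝 0) := by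
      refine squeeze_zero_norm' (a := fun R : ℝ => C * (1 + (2 * k : ℕ)) / R) ?_
        (tendsto_const_nhds.div_atTop tendsto_id)
      filter_upwards [eventually_gt_atTop 0] with R hR
      rw [le_div_iff₀ hR, Real.norm_eq_abs]
      linarith [(hb k R hR).2]
    have h2 := ih.sub h1
    simpa using h2

theorem exists_abs_hankelMoment_le {ν : ℝ} (hν : 0 < ν) :
    ∃ M, 0 < M ∧ ∀ (k : ℕ) (R : ℝ), 0 < R → |hankelMoment ν k R| ≤ M * (k + 1) := by
  obtain ⟨C, hC, hb⟩ := exists_abs_hankelMoment_sub_le hν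
  obtain ⟨D, hD, hbD⟩ := exists_abs_integral_besselJ_mul_besselJ_le hν
  have hcJ := continuous_besselJ hν
  have hcJ1 := continuous_besselJ (ν := ν + 1) (by linarith)
  obtain ⟨E, hE, hbE⟩ := exists_abs_integral_le_of_tail (by fun_prop) hD hbD
  refine ⟨E + C, by positivity, fun k R hR => ?_⟩
  induction k with
  | zero =>
    rw [hankelMoment_zero hν hR.le]
    have := hbE R hR.le
    push_cast; linarith
  | succ k ih =>
    have h1 := (hb k R hR).1
    have h2 := abs_sub_abs_le_abs_sub (hankelMoment ν (k + 1) R) (hankelMoment ν k R)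
    rw [abs_sub_comm] at h2
    push_cast
    nlinarith

/-- The projection is bounded uniformly in the truncation and locally uniformly in `r`. -/
theorem exists_abs_hankelProjection_le {ν : ℝ} (hν : 0 < ν) (r₀ : ℝ) :
    ∃ B, ∀ R r, 0 < R → 0 ≤ r → r ≤ r₀ → |hankelProjection ν R r| ≤ B := by
  obtain ⟨M, hM, hb⟩ := exists_abs_hankelMoment_le hν
  refine ⟨∑' k : ℕ, (k + 1) * |besselCoeff ν k| * ((r₀ / 2) ^ 2) ^ k * ((r₀ / 2) ^ ν * M),
    fun R r hR hr hr0 => ?_⟩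
  have hr0' : 0 ≤ r₀ := hr.trans hr0
  have hs := (summable_abs_besselCoeff_mul hν ((r₀ / 2) ^ 2) (by positivity)).mul_right
    ((r₀ / 2) ^ ν * M)
  rw [← (hasSum_hankelProjection hν R hr).tsum_eq, ← Real.norm_eq_abs]
  refine tsum_of_norm_bounded hs.hasSum fun k => ?_
  rw [norm_mul, norm_mul, norm_mul, Real.norm_of_nonneg (by positivity : 0 ≤ ((r / 2) ^ 2) ^ k),
    Real.norm_of_nonneg (by positivity : 0 ≤ (r / 2) ^ ν), Real.norm_eq_abs, Real.norm_eq_abs]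
  calc |besselCoeff ν k| * ((r / 2) ^ 2) ^ k * (r / 2) ^ ν * |hankelMoment ν k R|
      ≤ |besselCoeff ν k| * ((r₀ / 2) ^ 2) ^ k * (r₀ / 2) ^ ν * (M * (k + 1)) := by
        gcongr
        exact hb k R hR
    _ = _ := by ring

theorem tendsto_hankelProjection_of_tendsto {ν c : ℝ} (hν : 0 < ν)
    (hc : Tendsto (fun R => ∫ t in (0 : ℝ)..R, besselJ ν t * besselJ (ν + 1) t) atTop (𝓝 c))
    {r : ℝ} (hr : 0 ≤ r) :
    Tendsto (fun R => hankelProjection ν R r) atTop (𝓝 (c * besselJ ν r)) := by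
  obtain ⟨M, hM, hb⟩ := exists_abs_hankelMoment_le hν
  have h1 : c * besselJ ν r
      = ∑' k : ℕ, besselCoeff ν k * ((r / 2) ^ 2) ^ k * (r / 2) ^ ν * c := by
    rw [besselJ_eq_rpow_mul_besselEntire, besselEntire, tsum_mul_right, tsum_mul_right]
    ring
  rw [h1]
  have h2 : (fun R => hankelProjection ν R r) = fun R => ∑' k : ℕ,
      besselCoeff ν k * ((r / 2) ^ 2) ^ k * (r / 2) ^ ν * hankelMoment ν k R :=
    funext fun R => (hasSum_hankelProjection hν R hr).tsum_eq.symm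
  rw [h2]
  refine tendsto_tsum_of_dominated_convergence
    ((summable_abs_besselCoeff_mul hν ((r / 2) ^ 2) (by positivity)).mul_right
    ((r / 2) ^ ν * M)) (fun k => (tendsto_hankelMoment hν hc k).const_mul _) ?_
  filter_upwards [eventually_gt_atTop 0] with R hR k
  rw [norm_mul, norm_mul, norm_mul, Real.norm_of_nonneg (by positivity : 0 ≤ ((r / 2) ^ 2) ^ k),
    Real.norm_of_nonneg (by positivity : 0 ≤ (r / 2) ^ ν), Real.norm_eq_abs, Real.norm_eq_abs]
  calc |besselCoeff ν k| * ((r / 2) ^ 2) ^ k * (r / 2) ^ ν * |hankelMoment ν k R|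
      ≤ |besselCoeff ν k| * ((r / 2) ^ 2) ^ k * (r / 2) ^ ν * (M * (k + 1)) := by
        gcongr
        exact hb k R hR
    _ = _ := by ring

theorem continuous_hankelProjection_scale {ν : ℝ} (hν : 0 < ν) (R r : ℝ) :
    Continuous fun σ => hankelProjection ν (R * σ) (r * σ) := by
  have hc := continuous_besselJ hν
  unfold hankelProjection
  refine intervalIntegral.continuous_parametric_intervalIntegral_of_continuous ?_ (by fun_prop)
  have hcK : Continuous fun p : ℝ × ℝ => hankelKernel ν (r * p.1) p.2 :=
    Continuous.hankelKernel hν (by fun_prop) (by fun_prop)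
  simp only [Function.uncurry_def]
  fun_prop

theorem hankelProjection_scale {ν : ℝ} (R r : ℝ) (σ : ℝ) :
    hankelProjection ν (R * σ) (r * σ) = ∫ ρ in (0 : ℝ)..R,
      σ ^ 2 * hankelKernel ν (r * σ) (ρ * σ) * (ρ * besselJ ν (ρ * σ)) := by
  have h := intervalIntegral.mul_integral_comp_mul_left (a := 0) (b := R)
    (f := fun ρ => ρ * hankelKernel ν (r * σ) ρ * besselJ ν ρ) σ
  rw [mul_zero, mul_comm σ R] at h
  rw [hankelProjection, ← h, ← intervalIntegral.integral_const_mul]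
  congr 1; ext ρ
  rw [mul_comm σ ρ]; ring

theorem hasDerivAt_sq_mul_hankelKernel {ν : ℝ} (hν : 0 < ν) (r ρ σ : ℝ) :
    HasDerivAt (fun σ => σ ^ 2 * hankelKernel ν (r * σ) (ρ * σ))
      (σ * besselJ ν (r * σ) * besselJ ν (ρ * σ)) σ := by
  have hc := continuous_besselJ hν
  simp_rw [sq_mul_hankelKernel_mul]
  exact (Continuous.integral_hasStrictDerivAt (f := fun u => u * besselJ ν (r * u) *
    besselJ ν (ρ * u)) (by fun_prop) 0 σ).hasDerivAt

/-- Differentiation in a common scale `σ` of both arguments turns the kernel into a rank-one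
function; this reduces the square of the kernel to the projection of `J_ν`. -/
theorem integral_mul_sq_hankelKernel {ν : ℝ} (hν : 0 < ν) (R r : ℝ) :
    ∫ ρ in (0 : ℝ)..R, ρ * hankelKernel ν r ρ ^ 2
      = ∫ σ in (0 : ℝ)..1, 2 * σ * besselJ ν (r * σ) * hankelProjection ν (R * σ) (r * σ) := by
  have hc := continuous_besselJ hν
  have h1 : ∀ ρ, ρ * hankelKernel ν r ρ ^ 2 = ∫ σ in (0 : ℝ)..1, 2 * σ * besselJ ν (r * σ)
      * (σ ^ 2 * hankelKernel ν (r * σ) (ρ * σ) * (ρ * besselJ ν (ρ * σ))) := by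
    intro ρ
    have hcK : Continuous fun σ : ℝ => hankelKernel ν (r * σ) (ρ * σ) :=
      Continuous.hankelKernel hν (by fun_prop) (by fun_prop)
    have h := intervalIntegral.integral_eq_sub_of_hasDerivAt (a := 0) (b := 1)
      (fun σ _ => ((hasDerivAt_sq_mul_hankelKernel hν r ρ σ).pow 2).const_mul ρ)
      (Continuous.intervalIntegrable (by fun_prop) _ _)
    simp only [Pi.pow_apply, mul_one, one_pow, one_mul] at h
    simp only [ne_eq, OfNat.ofNat_ne_zero, not_false_eq_true, zero_pow, zero_mul, mul_zero,
      sub_zero] at h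
    rw [← h]
    congr 1; ext σ
    push_cast; ring
  simp_rw [h1]
  have hcK : Continuous fun p : ℝ × ℝ => hankelKernel ν (r * p.2) (p.1 * p.2) :=
    Continuous.hankelKernel hν (by fun_prop) (by fun_prop)
  rw [intervalIntegral_swap_of_continuous (by simp only [Function.uncurry_def]; fun_prop)]
  congr 1; ext σ
  rw [hankelProjection_scale, intervalIntegral.integral_const_mul]

/-- The integrand is again the integral over `σ ∈ [0,1]` of the derivative of
`σ² k(rσ,ρσ) G(ρσ)`, where `k` is `hankelKernel` and `G` is `besselTail`. -/
theorem integral_hankelKernel_mul_besselTail {ν : ℝ} (hν : 0 < ν) (R r : ℝ) :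
    ∫ ρ in (0 : ℝ)..R, hankelKernel ν r ρ * besselTail ν ρ
      = ∫ σ in (0 : ℝ)..1, (besselJ ν (r * σ) * ((1 - besselTail ν (R * σ) ^ 2) / 2)
        - hankelProjection ν (R * σ) (r * σ)) := by
  have hc := continuous_besselJ hν
  have hcG := continuous_besselTail hν
  have h1 : ∀ ρ, hankelKernel ν r ρ * besselTail ν ρ = ∫ σ in (0 : ℝ)..1,
      (besselJ ν (r * σ) * (σ * (besselJ ν (ρ * σ) * besselTail ν (ρ * σ)))
        - σ ^ 2 * hankelKernel ν (r * σ) (ρ * σ) * (ρ * besselJ ν (ρ * σ))) := by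
    intro ρ
    have hcK : Continuous fun σ : ℝ => hankelKernel ν (r * σ) (ρ * σ) :=
      Continuous.hankelKernel hν (by fun_prop) (by fun_prop)
    have h := intervalIntegral.integral_eq_sub_of_hasDerivAt (a := 0) (b := 1)
      (fun σ _ => (hasDerivAt_sq_mul_hankelKernel hν r ρ σ).mul
        ((hasDerivAt_besselTail hν (ρ * σ)).comp σ ((hasDerivAt_id σ).const_mul ρ)))
      (Continuous.intervalIntegrable (by simp only [Function.comp_def]; fun_prop) _ _)
    simp only [Pi.mul_apply, Function.comp, mul_one, one_pow, one_mul] at h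
    simp only [ne_eq, OfNat.ofNat_ne_zero, not_false_eq_true, zero_pow, zero_mul, mul_zero,
      sub_zero] at h
    rw [← h]
    congr 1; ext σ
    ring
  simp_rw [h1]
  have hcK : Continuous fun p : ℝ × ℝ => hankelKernel ν (r * p.2) (p.1 * p.2) :=
    Continuous.hankelKernel hν (by fun_prop) (by fun_prop)
  rw [intervalIntegral_swap_of_continuous (by simp only [Function.uncurry_def]; fun_prop)]
  congr 1; ext σ
  have hcK2 : Continuous fun ρ : ℝ => hankelKernel ν (r * σ) (ρ * σ) :=
    Continuous.hankelKernel hν (by fun_prop) (by fun_prop)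
  rw [hankelProjection_scale, intervalIntegral.integral_sub
    (Continuous.intervalIntegrable (by fun_prop) _ _)
    (Continuous.intervalIntegrable (by fun_prop) _ _), intervalIntegral.integral_const_mul]
  congr 2
  have h := intervalIntegral.integral_eq_sub_of_hasDerivAt (a := 0) (b := R)
    (f := fun ρ => (1 - besselTail ν (ρ * σ) ^ 2) / 2)
    (f' := fun ρ => σ * (besselJ ν (ρ * σ) * besselTail ν (ρ * σ)))
    (fun ρ _ => ?_) (Continuous.intervalIntegrable (by fun_prop) _ _)
  · rw [h]; simp [besselTail_zero]
  · have d := (hasDerivAt_besselTail hν (ρ * σ)).comp ρ ((hasDerivAt_id ρ).mul_const σ)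
    refine (((d.pow 2).const_sub 1).div_const 2).congr_deriv ?_
    simp only [Function.comp, id]
    push_cast; ring

theorem tendsto_integral_hankelProjection_mul {ν c : ℝ} (hν : 0 < ν)
    (hc : Tendsto (fun R => ∫ t in (0 : ℝ)..R, besselJ ν t * besselJ (ν + 1) t) atTop (𝓝 c))
    {r : ℝ} (hr : 0 ≤ r) {g : ℝ → ℝ} (hg : Continuous g) :
    Tendsto (fun R => ∫ σ in (0 : ℝ)..1, g σ * hankelProjection ν (R * σ) (r * σ)) atTop
      (𝓝 (∫ σ in (0 : ℝ)..1, g σ * (c * besselJ ν (r * σ)))) := by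
  obtain ⟨B, hB⟩ := exists_abs_hankelProjection_le hν r
  refine intervalIntegral.tendsto_integral_filter_of_dominated_convergence
    (fun σ => |g σ| * B) ?_ ?_ (Continuous.intervalIntegrable (by fun_prop) _ _) ?_
  · exact Eventually.of_forall fun R =>
      (hg.mul (continuous_hankelProjection_scale hν R r)).aestronglyMeasurable
  · filter_upwards [eventually_gt_atTop 0] with R hR
    refine ae_of_all _ fun σ hσ => ?_
    rw [Set.uIoc_of_le zero_le_one] at hσ
    rw [norm_mul, Real.norm_eq_abs, Real.norm_eq_abs]
    gcongr
    exact hB _ _ (mul_pos hR hσ.1) (mul_nonneg hr hσ.1.le) (mul_le_of_le_one_right hr hσ.2)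
  · refine ae_of_all _ fun σ hσ => ?_
    rw [Set.uIoc_of_le zero_le_one] at hσ
    exact ((tendsto_hankelProjection_of_tendsto hν hc (mul_nonneg hr hσ.1.le)).comp
      (tendsto_id.atTop_mul_const hσ.1)).const_mul _

theorem integral_besselJ_mul {ν : ℝ} (hν : 0 < ν) {r : ℝ} (hr : 0 < r) :
    ∫ σ in (0 : ℝ)..1, besselJ ν (r * σ) = (1 - besselTail ν r) / r := by
  rw [intervalIntegral.integral_comp_mul_left (besselJ ν) hr.ne', integral_besselJ_eq hν,
    mul_zero, mul_one, besselTail_zero, smul_eq_mul]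
  field_simp

theorem tendsto_integral_hankelKernel_mul_besselTail_of_tendsto {ν c : ℝ} (hν : 0 < ν)
    (hc : Tendsto (fun R => ∫ t in (0 : ℝ)..R, besselJ ν t * besselJ (ν + 1) t) atTop (𝓝 c))
    {r : ℝ} (hr : 0 < r) :
    Tendsto (fun R => ∫ ρ in (0 : ℝ)..R, hankelKernel ν r ρ * besselTail ν ρ) atTop
      (𝓝 ((1 / 2 - c) * ((1 - besselTail ν r) / r))) := by
  have hcJ := continuous_besselJ hν
  have hcG := continuous_besselTail hν
  obtain ⟨C, hC, hb⟩ := exists_besselTail_bound hν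
  have h1 : Tendsto (fun R => ∫ σ in (0 : ℝ)..1,
      besselJ ν (r * σ) * ((1 - besselTail ν (R * σ) ^ 2) / 2)) atTop
      (𝓝 (∫ σ in (0 : ℝ)..1, besselJ ν (r * σ) * ((1 - 0 ^ 2) / 2))) := by
    refine intervalIntegral.tendsto_integral_filter_of_dominated_convergence
      (fun σ => |besselJ ν (r * σ)| * ((1 + C ^ 2) / 2)) ?_ ?_
      (Continuous.intervalIntegrable (by fun_prop) _ _) ?_
    · exact Eventually.of_forall fun R => Continuous.aestronglyMeasurable (by fun_prop)
    · filter_upwards [eventually_gt_atTop 0] with R hR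
      refine ae_of_all _ fun σ hσ => ?_
      rw [Set.uIoc_of_le zero_le_one] at hσ
      rw [norm_mul, Real.norm_eq_abs, Real.norm_eq_abs]
      refine mul_le_mul_of_nonneg_left ?_ (abs_nonneg _)
      have h2 := (hb (R * σ) (mul_pos hR hσ.1).le).1
      have h3 : besselTail ν (R * σ) ^ 2 ≤ C ^ 2 := sq_le_sq' (abs_le.mp h2).1 (abs_le.mp h2).2
      have h4 := sq_nonneg (besselTail ν (R * σ))
      rw [abs_le]
      constructor <;> linarith
    · refine ae_of_all _ fun σ hσ => ?_
      rw [Set.uIoc_of_le zero_le_one] at hσ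
      have := (tendsto_besselTail hν).comp (tendsto_id.atTop_mul_const hσ.1)
      exact (((this.pow 2).const_sub 1).div_const 2).const_mul _
  have h2 := tendsto_integral_hankelProjection_mul hν hc hr.le (g := fun _ => 1) continuous_const
  have h3 := h1.sub h2
  simp only [one_mul, intervalIntegral.integral_mul_const, intervalIntegral.integral_const_mul,
    integral_besselJ_mul hν hr] at h3
  have hcT := fun R => continuous_hankelProjection_scale hν R r
  convert h3 using 2
  · rw [integral_hankelKernel_mul_besselTail hν, intervalIntegral.integral_sub
      (Continuous.intervalIntegrable (by fun_prop) _ _)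
      (Continuous.intervalIntegrable (hcT _) _ _)]
  · ring

/-! ### The value of the constant and the three limits -/

theorem integrableOn_rpow_mul_abs_one_sub_rpow :
    IntegrableOn (fun t : ℝ => t ^ (-(7 / 8) : ℝ) * |1 - t| ^ (-(3 / 4) : ℝ)) (Set.Ioi 0) := by
  have hmeas : Measurable fun t : ℝ => t ^ (-(7 / 8) : ℝ) * |1 - t| ^ (-(3 / 4) : ℝ) := by fun_prop
  have hcover : Set.Ioi (0 : ℝ) ⊆ Set.Ioc 0 (1 / 2) ∪ Set.Ioc (1 / 2) 1 ∪ Set.Ioc 1 2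
      ∪ Set.Ioi 2 := by
    intro t ht
    have ht0 : 0 < t := ht
    simp only [Set.mem_union, Set.mem_Ioc, Set.mem_Ioi]
    by_cases h1 : t ≤ 1 / 2
    · exact Or.inl (Or.inl (Or.inl ⟨ht0, h1⟩))
    by_cases h2 : t ≤ 1
    · exact Or.inl (Or.inl (Or.inr ⟨not_le.mp h1, h2⟩))
    by_cases h3 : t ≤ 2
    · exact Or.inl (Or.inr ⟨not_le.mp h2, h3⟩)
    · exact Or.inr (not_le.mp h3)
  have half : ∀ t : ℝ, 1 / 2 ≤ t → t ^ (-(7 / 8) : ℝ) ≤ (1 / 2 : ℝ) ^ (-(7 / 8) : ℝ) := fun t ht =>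
    Real.rpow_le_rpow_of_nonpos (by norm_num) ht (by norm_num)
  refine IntegrableOn.mono_set (((IntegrableOn.union ?_ ?_).union ?_).union ?_) hcover
  · have h : IntegrableOn (fun t : ℝ => t ^ (-(7 / 8) : ℝ) * (1 / 2 : ℝ) ^ (-(3 / 4) : ℝ))
        (Set.Ioc 0 (1 / 2)) :=
      ((intervalIntegral.intervalIntegrable_rpow' (by norm_num)).1).mul_const _
    refine h.mono' hmeas.aestronglyMeasurable ?_
    filter_upwards [ae_restrict_mem measurableSet_Ioc] with t ht
    have ht0 : 0 < t := ht.1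
    rw [Real.norm_of_nonneg (by positivity), abs_of_nonneg (by linarith [ht.2])]
    exact mul_le_mul_of_nonneg_left (Real.rpow_le_rpow_of_nonpos (by norm_num)
      (by linarith [ht.2]) (by norm_num)) (by positivity)
  · have h : IntegrableOn (fun t : ℝ => (1 / 2 : ℝ) ^ (-(7 / 8) : ℝ) * (1 - t) ^ (-(3 / 4) : ℝ))
        (Set.Ioc (1 / 2) 1) := by
      have h0 := (intervalIntegral.intervalIntegrable_rpow' (a := 1 / 2) (b := 0)
        (r := -(3 / 4)) (by norm_num)).comp_sub_left 1
      norm_num at h0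
      exact (h0.1).const_mul _
    refine h.mono' hmeas.aestronglyMeasurable ?_
    filter_upwards [ae_restrict_mem measurableSet_Ioc] with t ht
    have ht0 : 0 < t := by linarith [ht.1]
    have ht1 : 0 ≤ 1 - t := by linarith [ht.2]
    rw [Real.norm_of_nonneg (by positivity), abs_of_nonneg ht1]
    exact mul_le_mul_of_nonneg_right (half t ht.1.le) (by positivity)
  · have h : IntegrableOn (fun t : ℝ => (1 / 2 : ℝ) ^ (-(7 / 8) : ℝ) * (t - 1) ^ (-(3 / 4) : ℝ))
        (Set.Ioc 1 2) := by
      have h0 := (intervalIntegral.intervalIntegrable_rpow' (a := 0) (b := 1)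
        (r := -(3 / 4)) (by norm_num)).comp_sub_right 1
      norm_num at h0
      exact (h0.1).const_mul _
    refine h.mono' hmeas.aestronglyMeasurable ?_
    filter_upwards [ae_restrict_mem measurableSet_Ioc] with t ht
    have ht0 : 0 < t := by linarith [ht.1]
    have ht1 : 0 ≤ t - 1 := by linarith [ht.1]
    rw [Real.norm_of_nonneg (by positivity), abs_sub_comm, abs_of_nonneg ht1]
    exact mul_le_mul_of_nonneg_right (half t (by linarith [ht.1])) (by positivity)
  · have h : IntegrableOn (fun t : ℝ => (1 / 2 : ℝ) ^ (-(3 / 4) : ℝ) * t ^ (-(13 / 8) : ℝ))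
        (Set.Ioi 2) :=
      (integrableOn_Ioi_rpow_of_lt (by norm_num) (by norm_num)).const_mul _
    refine h.mono' hmeas.aestronglyMeasurable ?_
    filter_upwards [ae_restrict_mem measurableSet_Ioi] with t ht
    have ht2 : 2 < t := ht
    have ht0 : 0 < t := by linarith
    have ht1 : 0 ≤ t - 1 := by linarith
    rw [Real.norm_of_nonneg (by positivity), abs_sub_comm, abs_of_nonneg ht1]
    have h1 : (t - 1) ^ (-(3 / 4) : ℝ) ≤ (1 / 2 * t) ^ (-(3 / 4) : ℝ) :=
      Real.rpow_le_rpow_of_nonpos (by linarith) (by linarith) (by norm_num)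
    rw [Real.mul_rpow (by norm_num) ht0.le] at h1
    calc t ^ (-(7 / 8) : ℝ) * (t - 1) ^ (-(3 / 4) : ℝ)
        ≤ t ^ (-(7 / 8) : ℝ) * ((1 / 2 : ℝ) ^ (-(3 / 4) : ℝ) * t ^ (-(3 / 4) : ℝ)) := by gcongr
      _ = (1 / 2 : ℝ) ^ (-(3 / 4) : ℝ) * (t ^ (-(7 / 8) : ℝ) * t ^ (-(3 / 4) : ℝ)) := by ring
      _ = _ := by rw [← Real.rpow_add ht0]; norm_num

/-- Interpolation between the bounds `x ≤ C` and `d x ≤ C`. -/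
theorem rpow_mul_le_of_le {x d C : ℝ} (hx : 0 ≤ x) (hd : 0 ≤ d) (h1 : x ≤ C) (h2 : d * x ≤ C) :
    d ^ (3 / 4 : ℝ) * x ≤ C := by
  rcases le_total d 1 with h | h
  · exact (mul_le_of_le_one_left hx (Real.rpow_le_one hd h (by norm_num))).trans h1
  · refine (mul_le_mul_of_nonneg_right ?_ hx).trans h2
    calc d ^ (3 / 4 : ℝ) ≤ d ^ (1 : ℝ) := Real.rpow_le_rpow_of_exponent_le h (by norm_num)
      _ = d := Real.rpow_one d

/-- Uniformly in `R`, the integral is `o(1/r)` as `r → ∞`. -/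
theorem exists_abs_integral_hankelKernel_mul_besselTail_le {ν : ℝ} (hν : 0 < ν) :
    ∃ C, ∀ R r, 0 < R → 0 < r →
      |∫ ρ in (0 : ℝ)..R, hankelKernel ν r ρ * besselTail ν ρ| ≤ C * r ^ (-(9 / 8) : ℝ) := by
  obtain ⟨C, hC, hb⟩ := exists_hankelKernel_bound hν
  obtain ⟨D, hD, hbD⟩ := exists_besselTail_bound hν
  set f : ℝ → ℝ := fun t => t ^ (-(7 / 8) : ℝ) * |1 - t| ^ (-(3 / 4) : ℝ) with hf
  have hfi : IntegrableOn f (Set.Ioi 0) := integrableOn_rpow_mul_abs_one_sub_rpow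
  refine ⟨C * D * ∫ t in Set.Ioi (0 : ℝ), f t, fun R r hR hr => ?_⟩
  -- The bounds are interpolated with the exponent `3/4`: the singularities at `t = 0` and `t = 1`
  -- become integrable, and a power of `r` remains to beat `1/r`.
  have hpt : ∀ t, 0 < t → t ≠ 1 → ‖hankelKernel ν r (r * t) * besselTail ν (r * t)‖
      ≤ C * D * r ^ (-(17 / 8) : ℝ) * f t := by
    intro t ht ht1
    have hrt : 0 < r * t := mul_pos hr ht
    obtain ⟨k1, k2⟩ := hb r (r * t) hr hrt
    obtain ⟨g1, g2⟩ := hbD (r * t) hrt.le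
    have hk := rpow_mul_le_of_le (x := √r * √(r * t) * |hankelKernel ν r (r * t)|)
      (d := |r - r * t|) (by positivity) (abs_nonneg _) k1 (by linarith)
    have hg := rpow_mul_le_of_le (x := |besselTail ν (r * t)|) (d := √(r * t))
      (abs_nonneg _) (Real.sqrt_nonneg _) g1 g2
    have hd : 0 < |1 - t| := abs_pos.mpr (sub_ne_zero.mpr (Ne.symm ht1))
    rw [show r - r * t = r * (1 - t) by ring, abs_mul, abs_of_pos hr,
      Real.mul_rpow hr.le hd.le] at hk
    have e1 : √r * √(r * t) = r * t ^ (1 / 2 : ℝ) := by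
      rw [Real.sqrt_mul hr.le, ← mul_assoc, Real.mul_self_sqrt hr.le, Real.sqrt_eq_rpow]
    have e2 : √(r * t) ^ (3 / 4 : ℝ) = r ^ (3 / 8 : ℝ) * t ^ (3 / 8 : ℝ) := by
      rw [Real.sqrt_eq_rpow, ← Real.rpow_mul hrt.le, Real.mul_rpow hr.le ht.le]
      norm_num
    rw [e1] at hk
    rw [e2] at hg
    have hprod := mul_le_mul hk hg (by positivity) hC.le
    have er : r ^ (17 / 8 : ℝ) = r ^ (3 / 4 : ℝ) * r * r ^ (3 / 8 : ℝ) := by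
      rw [← Real.rpow_add_one hr.ne', ← Real.rpow_add hr]; norm_num
    have et : t ^ (7 / 8 : ℝ) = t ^ (1 / 2 : ℝ) * t ^ (3 / 8 : ℝ) := by
      rw [← Real.rpow_add ht]; norm_num
    have hX : r ^ (17 / 8 : ℝ) * (t ^ (7 / 8 : ℝ) * |1 - t| ^ (3 / 4 : ℝ))
        * ‖hankelKernel ν r (r * t) * besselTail ν (r * t)‖ ≤ C * D := by
      rw [norm_mul, Real.norm_eq_abs, Real.norm_eq_abs, er, et]
      calc _ = _ := by ring
        _ ≤ C * D := hprod
    simp only [hf]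
    rw [Real.rpow_neg hr.le, Real.rpow_neg ht.le, Real.rpow_neg hd.le, ← mul_inv, mul_assoc (C * D),
      ← mul_inv, ← div_eq_mul_inv, le_div_iff₀ (by positivity)]
    linarith
  have hsub := intervalIntegral.mul_integral_comp_mul_left (a := 0) (b := R / r)
    (f := fun ρ => hankelKernel ν r ρ * besselTail ν ρ) r
  rw [mul_zero, mul_div_cancel₀ _ hr.ne'] at hsub
  rw [← hsub, abs_mul, abs_of_pos hr]
  have hRr : 0 ≤ R / r := by positivity
  have h1 := intervalIntegral.norm_integral_le_of_norm_le (μ := volume) hRr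
    (f := fun t => hankelKernel ν r (r * t) * besselTail ν (r * t))
    (g := fun t => C * D * r ^ (-(17 / 8) : ℝ) * f t) ?_ ?_
  · rw [intervalIntegral.integral_const_mul, intervalIntegral.integral_of_le (f := f) hRr] at h1
    have h2 : ∫ t in Set.Ioc 0 (R / r), f t ≤ ∫ t in Set.Ioi (0 : ℝ), f t := by
      refine setIntegral_mono_set hfi ?_ (Set.Ioc_subset_Ioi_self).eventuallyLE
      filter_upwards [ae_restrict_mem measurableSet_Ioi] with t ht
      have ht0 : (0 : ℝ) < t := ht
      simp only [hf, Pi.zero_apply]; positivity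
    have hr98 : r * r ^ (-(17 / 8) : ℝ) = r ^ (-(9 / 8) : ℝ) := by
      rw [mul_comm, ← Real.rpow_add_one hr.ne']; norm_num
    calc r * |∫ t in (0 : ℝ)..R / r, hankelKernel ν r (r * t) * besselTail ν (r * t)|
        ≤ r * (C * D * r ^ (-(17 / 8) : ℝ) * ∫ t in Set.Ioi (0 : ℝ), f t) := by
          refine mul_le_mul_of_nonneg_left (h1.trans ?_) hr.le
          exact mul_le_mul_of_nonneg_left h2 (by positivity)
      _ = _ := by rw [← hr98]; ring
  · filter_upwards [compl_mem_ae_iff.mpr (measure_singleton (1 : ℝ))] with t ht1 ht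
    exact hpt t ht.1 ht1
  · rw [intervalIntegrable_iff_integrableOn_Ioc_of_le hRr]
    exact (hfi.mono_set Set.Ioc_subset_Ioi_self).const_mul _

/-- `∫_0^∞ J_ν J_{ν+1} = 1/2`: otherwise `∫_0^∞ k(r,ρ) ∫_ρ^∞ J_ν dρ` would be of exact order
`1/r`. -/
theorem tendsto_integral_besselJ_mul_besselJ {ν : ℝ} (hν : 0 < ν) :
    Tendsto (fun R => ∫ t in (0 : ℝ)..R, besselJ ν t * besselJ (ν + 1) t) atTop (𝓝 (1 / 2)) := by
  obtain ⟨D, hD, hbD⟩ := exists_abs_integral_besselJ_mul_besselJ_le hν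
  have hcJ := continuous_besselJ hν
  have hcJ1 := continuous_besselJ (ν := ν + 1) (by linarith)
  obtain ⟨c, hc⟩ := exists_tendsto_integral_of_tail (by fun_prop) hD hbD
  obtain ⟨C, hC⟩ := exists_abs_integral_hankelKernel_mul_besselTail_le hν
  have h1 : ∀ r, 0 < r → |(1 / 2 - c) * (1 - besselTail ν r)| ≤ C * r ^ (-(1 / 8) : ℝ) := by
    intro r hr
    have h := (tendsto_integral_hankelKernel_mul_besselTail_of_tendsto hν hc hr).abs
    have h2 := le_of_tendsto h
      (by filter_upwards [eventually_gt_atTop 0] with R hR using hC R r hR hr)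
    rw [← mul_div_assoc, abs_div, abs_of_pos hr, div_le_iff₀ hr, mul_assoc,
      ← Real.rpow_add_one hr.ne'] at h2
    norm_num at h2 ⊢
    exact h2
  have h2 : Tendsto (fun r => |(1 / 2 - c) * (1 - besselTail ν r)|) atTop
      (𝓝 |(1 / 2 - c) * (1 - 0)|) :=
    (((tendsto_besselTail hν).const_sub 1).const_mul _).abs
  have h3 : Tendsto (fun r : ℝ => C * r ^ (-(1 / 8) : ℝ)) atTop (𝓝 (C * 0)) :=
    (tendsto_rpow_neg_atTop (by norm_num)).const_mul C
  have h4 := le_of_tendsto_of_tendsto h2 h3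
    (by filter_upwards [eventually_gt_atTop 0] with r hr using h1 r hr)
  rw [mul_zero, sub_zero, mul_one] at h4
  have h5 : c = 1 / 2 := by
    have := abs_nonpos_iff.mp h4
    linarith
  rwa [h5] at hc

theorem tendsto_integral_hankelKernel_mul_besselJ {ν : ℝ} (hν : 0 < ν) {r : ℝ} (hr : 0 < r) :
    Tendsto (fun R => ∫ ρ in (0 : ℝ)..R, ρ * hankelKernel ν r ρ * besselJ ν ρ) atTop
      (𝓝 (besselJ ν r / 2)) := by
  have := tendsto_hankelProjection_of_tendsto hν (tendsto_integral_besselJ_mul_besselJ hν) hr.le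
  rwa [one_div_mul_eq_div] at this

theorem tendsto_integral_hankelKernel_mul_besselTail {ν : ℝ} (hν : 0 < ν) {r : ℝ} (hr : 0 < r) :
    Tendsto (fun R => ∫ ρ in (0 : ℝ)..R, hankelKernel ν r ρ * besselTail ν ρ) atTop (𝓝 0) := by
  have := tendsto_integral_hankelKernel_mul_besselTail_of_tendsto hν
    (tendsto_integral_besselJ_mul_besselJ hν) hr
  rwa [sub_self, zero_mul] at this

/-- The determinantal kernel is reproducing on the diagonal. -/
theorem tendsto_integral_mul_sq_hankelKernel {ν : ℝ} (hν : 0 < ν) {r : ℝ} (hr : 0 < r) :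
    Tendsto (fun R => ∫ ρ in (0 : ℝ)..R, ρ * hankelKernel ν r ρ ^ 2) atTop
      (𝓝 (hankelKernel ν r r)) := by
  have hcJ := continuous_besselJ hν
  have h := tendsto_integral_hankelProjection_mul hν (tendsto_integral_besselJ_mul_besselJ hν)
    hr.le (g := fun σ => 2 * σ * besselJ ν (r * σ)) (by fun_prop)
  simp_rw [integral_mul_sq_hankelKernel hν]
  convert h using 2
  unfold hankelKernel
  congr 1; ext u
  ring

/-! ### The orthogonal kernel in the square-root variables -/

/-- The scalar kernel `K_{1,s}(x,y)` in the variables `x = r²`, `y = ρ²`, multiplied by the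
Jacobian `2ρ`; here `ν = s+1`. -/
noncomputable def orthogonalHankelKernel (ν r ρ : ℝ) : ℝ :=
  r * hankelKernel ν r ρ + besselJ ν ρ * besselTail ν r / 2

/-- The function `r ∂_r` of `hankelKernel`; the integrand uses `t J_ν'(t) = ν J_ν(t) - t J_{ν+1}(t)`
in order to be continuous at `0`. -/
noncomputable def hankelKernelEuler (ν r ρ : ℝ) : ℝ :=
  ∫ u in (0 : ℝ)..1,
    u * (ν * besselJ ν (r * u) - r * u * besselJ (ν + 1) (r * u)) * besselJ ν (ρ * u)

/-- The derivative of `orthogonalHankelKernel` in its first variable; it is antisymmetric. -/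
noncomputable def orthogonalHankelDeriv (ν r ρ : ℝ) : ℝ :=
  (hankelKernelEuler ν r ρ - hankelKernelEuler ν ρ r) / 2

theorem orthogonalHankelDeriv_swap (ν r ρ : ℝ) :
    orthogonalHankelDeriv ν ρ r = -orthogonalHankelDeriv ν r ρ := by
  unfold orthogonalHankelDeriv; ring

theorem continuous_orthogonalHankelKernel_right {ν : ℝ} (hν : 0 < ν) (r : ℝ) :
    Continuous fun ρ => orthogonalHankelKernel ν r ρ := by
  have hc := continuous_besselJ hν
  have hcK : Continuous fun ρ : ℝ => hankelKernel ν r ρ :=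
    Continuous.hankelKernel hν (by fun_prop) (by fun_prop)
  unfold orthogonalHankelKernel
  fun_prop

theorem continuous_orthogonalHankelKernel_left {ν : ℝ} (hν : 0 < ν) (ρ : ℝ) :
    Continuous fun r => orthogonalHankelKernel ν r ρ := by
  have hcG := continuous_besselTail hν
  have hcK : Continuous fun r : ℝ => hankelKernel ν r ρ :=
    Continuous.hankelKernel hν (by fun_prop) (by fun_prop)
  unfold orthogonalHankelKernel
  fun_prop

theorem continuous_hankelKernelEuler {ν : ℝ} (hν : 0 < ν) :
    Continuous fun p : ℝ × ℝ => hankelKernelEuler ν p.1 p.2 := by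
  have := continuous_besselJ hν
  have := continuous_besselJ (ν := ν + 1) (by linarith)
  unfold hankelKernelEuler
  apply intervalIntegral.continuous_parametric_intervalIntegral_of_continuous'
  simp only [Function.uncurry_def]
  fun_prop

theorem continuous_orthogonalHankelDeriv {ν : ℝ} (hν : 0 < ν) (r : ℝ) :
    Continuous fun ρ => orthogonalHankelDeriv ν r ρ := by
  have h := continuous_hankelKernelEuler hν
  have h1 : Continuous fun ρ : ℝ => hankelKernelEuler ν r ρ :=
    h.comp₂ continuous_const continuous_id
  have h2 : Continuous fun ρ : ℝ => hankelKernelEuler ν ρ r :=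
    h.comp₂ continuous_id continuous_const
  unfold orthogonalHankelDeriv
  fun_prop

theorem hasDerivAt_hankelKernel {ν : ℝ} (hν : 0 < ν) {r : ℝ} (hr : 0 < r) (ρ : ℝ) :
    HasDerivAt (fun r => hankelKernel ν r ρ) (hankelKernelEuler ν r ρ / r) r := by
  have hc := continuous_besselJ hν
  have hc1 := continuous_besselJ (ν := ν + 1) (by linarith)
  set G : ℝ → ℝ → ℝ := fun x u =>
    u * (ν * besselJ ν (x * u) - x * u * besselJ (ν + 1) (x * u)) * besselJ ν (ρ * u) / x with hG
  have hcG : ContinuousOn (fun p : ℝ × ℝ => G p.1 p.2)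
      (Set.Icc (r / 2) (2 * r) ×ˢ Set.Icc (0 : ℝ) 1) := by
    refine ContinuousOn.div (Continuous.continuousOn (by fun_prop)) continuousOn_fst fun p hp => ?_
    have := hp.1.1
    exact (by linarith : 0 < p.1).ne'
  obtain ⟨M, hM⟩ := (isCompact_Icc.prod isCompact_Icc).exists_bound_of_continuousOn hcG
  have h := intervalIntegral.hasDerivAt_integral_of_dominated_loc_of_deriv_le (μ := volume)
    (a := 0) (b := 1) (F := fun x u => u * besselJ ν (x * u) * besselJ ν (ρ * u)) (F' := G)
    (x₀ := r) (s := Set.Icc (r / 2) (2 * r)) (bound := fun _ => M)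
    (Icc_mem_nhds (by linarith) (by linarith))
    (Eventually.of_forall fun x => Continuous.aestronglyMeasurable (by fun_prop))
    (Continuous.intervalIntegrable (by fun_prop) _ _)
    (Continuous.aestronglyMeasurable (by simp only [hG]; fun_prop))
    (ae_of_all _ fun u hu x hx => ?_) intervalIntegrable_const (ae_of_all _ fun u hu x hx => ?_)
  · refine h.2.congr_deriv ?_
    simp only [hG]
    rw [intervalIntegral.integral_div, hankelKernelEuler]
  · rw [Set.uIoc_of_le zero_le_one] at hu
    exact hM (x, u) ⟨hx, hu.1.le, hu.2⟩
  · rw [Set.uIoc_of_le zero_le_one] at hu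
    have hx0 : 0 < x := by linarith [hx.1]
    have hu0 : 0 < u := hu.1
    have d := (hasDerivAt_besselJ hν (mul_pos hx0 hu0)).comp x ((hasDerivAt_id x).mul_const u)
    refine ((d.const_mul u).mul_const (besselJ ν (ρ * u))).congr_deriv ?_
    simp only [hG]
    field_simp

/-- Euler's relation for the kernel, from its homogeneity under a common scaling. -/
theorem hankelKernelEuler_add {ν : ℝ} (hν : 0 < ν) {r ρ : ℝ} (hr : 0 < r) (hρ : 0 < ρ) :
    hankelKernelEuler ν r ρ + hankelKernelEuler ν ρ r + 2 * hankelKernel ν r ρ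
      = besselJ ν r * besselJ ν ρ := by
  have hc := continuous_besselJ hν
  have hc1 := continuous_besselJ (ν := ν + 1) (by linarith)
  unfold hankelKernelEuler hankelKernel
  rw [← intervalIntegral.integral_const_mul, ← intervalIntegral.integral_add
    (Continuous.intervalIntegrable (by fun_prop) _ _)
    (Continuous.intervalIntegrable (by fun_prop) _ _), ← intervalIntegral.integral_add
    (Continuous.intervalIntegrable (by fun_prop) _ _)
    (Continuous.intervalIntegrable (by fun_prop) _ _)]
  rw [intervalIntegral.integral_eq_sub_of_hasDerivAt_of_le zero_le_one
    (f := fun u => u ^ 2 * (besselJ ν (r * u) * besselJ ν (ρ * u)))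
    (by fun_prop) (fun u hu => ?_) (Continuous.intervalIntegrable (by fun_prop) _ _)]
  · simp
  · have hu0 : 0 < u := hu.1
    refine ((hasDerivAt_pow 2 u).mul ((hasDerivAt_besselJ_mul hν hr hu0).mul
      (hasDerivAt_besselJ_mul hν hρ hu0))).congr_deriv ?_
    simp only [Pi.mul_apply]
    push_cast
    field_simp
    ring

theorem hasDerivAt_orthogonalHankelKernel {ν : ℝ} (hν : 0 < ν) {r ρ : ℝ} (hr : 0 < r)
    (hρ : 0 < ρ) :
    HasDerivAt (fun r => orthogonalHankelKernel ν r ρ) (orthogonalHankelDeriv ν r ρ) r := by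
  have d := ((hasDerivAt_id r).mul (hasDerivAt_hankelKernel hν hr ρ)).add
    (((hasDerivAt_besselTail hν r).const_mul (besselJ ν ρ)).div_const 2)
  refine d.congr_deriv ?_
  have h := hankelKernelEuler_add hν hr hρ
  unfold orthogonalHankelDeriv
  simp only [id]
  field_simp
  linarith

theorem intervalIntegrable_sign_mul {b : ℝ → ℝ} (hb : Continuous b) {r R : ℝ} (hr : 0 ≤ r)
    (hR : r ≤ R) :
    IntervalIntegrable (fun ρ => Real.sign (r - ρ) * b ρ) volume 0 r ∧
    IntervalIntegrable (fun ρ => Real.sign (r - ρ) * b ρ) volume r R := by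
  constructor
  · refine (hb.intervalIntegrable 0 r).congr_uIoo fun ρ hρ => ?_
    rw [Set.uIoo_of_le hr] at hρ
    rw [Real.sign_of_pos (by linarith [hρ.2]), one_mul]
  · refine (hb.neg.intervalIntegrable r R).congr_uIoo fun ρ hρ => ?_
    rw [Set.uIoo_of_le hR] at hρ
    simp only [Pi.neg_apply]
    rw [Real.sign_of_neg (by linarith [hρ.1]), neg_one_mul]

/-- Integration by parts for the off-diagonal product of the kernel, with the jump of `sign` at
the diagonal taken into account. -/
theorem integral_mul_add_sign_mul {A B b : ℝ → ℝ} (hA : Continuous A) (hB : Continuous B)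
    (hb : Continuous b) (hBb : ∀ ρ, 0 < ρ → HasDerivAt B (b ρ) ρ) {r R : ℝ} (hr : 0 < r)
    (hR : r ≤ R) :
    ∫ ρ in (0 : ℝ)..R, (A ρ * B ρ + (-(∫ t in r..ρ, A t) - 1 / 2 * Real.sign (r - ρ)) * b ρ)
      = 2 * (∫ ρ in (0 : ℝ)..R, A ρ * B ρ) - (∫ t in r..R, A t) * B R
        - (∫ t in (0 : ℝ)..r, A t) * B 0 - B r + B 0 / 2 + B R / 2 := by
  have hprim : Continuous fun ρ => ∫ t in r..ρ, A t :=
    intervalIntegral.continuous_primitive (fun a b => hA.intervalIntegrable a b) r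
  have hftc : ∀ x y, 0 ≤ x → x ≤ y → ∫ ρ in x..y, b ρ = B y - B x := fun x y hx hxy =>
    intervalIntegral.integral_eq_sub_of_hasDerivAt_of_le hxy hB.continuousOn
      (fun ρ hρ => hBb ρ (hx.trans_lt hρ.1)) (hb.intervalIntegrable _ _)
  obtain ⟨i1, i2⟩ := intervalIntegrable_sign_mul hb hr.le hR
  have hs : ∫ ρ in (0 : ℝ)..R, Real.sign (r - ρ) * b ρ = 2 * B r - B 0 - B R := by
    rw [← intervalIntegral.integral_add_adjacent_intervals i1 i2,
      intervalIntegral.integral_congr_Ioo_of_le (g := b) hr.le fun ρ hρ => ?_,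
      intervalIntegral.integral_congr_Ioo_of_le (g := fun ρ => -b ρ) hR fun ρ hρ => ?_,
      intervalIntegral.integral_neg, hftc 0 r le_rfl hr.le, hftc r R hr.le hR]
    · ring
    · rw [Real.sign_of_neg (by linarith [hρ.1]), neg_one_mul]
    · rw [Real.sign_of_pos (by linarith [hρ.2]), one_mul]
  have hparts := intervalIntegral.integral_eq_sub_of_hasDerivAt_of_le (hr.le.trans hR)
    (f := fun ρ => (∫ t in r..ρ, A t) * B ρ) (f' := fun ρ => A ρ * B ρ + (∫ t in r..ρ, A t) * b ρ)
    (hprim.mul hB).continuousOn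
    (fun ρ hρ => ((hA.integral_hasStrictDerivAt r ρ).hasDerivAt).mul (hBb ρ hρ.1))
    (Continuous.intervalIntegrable (by fun_prop) _ _)
  have hAB : IntervalIntegrable (fun ρ => A ρ * B ρ) volume 0 R :=
    Continuous.intervalIntegrable (by fun_prop) _ _
  have hHb : IntervalIntegrable (fun ρ => (∫ t in r..ρ, A t) * b ρ) volume 0 R :=
    Continuous.intervalIntegrable (by fun_prop) _ _
  have hsplit : ∀ ρ, A ρ * B ρ + (-(∫ t in r..ρ, A t) - 1 / 2 * Real.sign (r - ρ)) * b ρ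
      = A ρ * B ρ - (∫ t in r..ρ, A t) * b ρ - 1 / 2 * (Real.sign (r - ρ) * b ρ) := fun ρ => by ring
  rw [intervalIntegral.integral_add hAB hHb] at hparts
  simp_rw [hsplit]
  rw [intervalIntegral.integral_sub (hAB.sub hHb) ((i1.trans i2).const_mul _),
    intervalIntegral.integral_sub hAB hHb, intervalIntegral.integral_const_mul, hs]
  rw [intervalIntegral.integral_symm 0 r] at hparts
  linarith

theorem integral_hankelKernel_eq {ν : ℝ} (hν : 0 < ν) (r R : ℝ) :
    ∫ ρ in (0 : ℝ)..R, hankelKernel ν r ρ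
      = ∫ u in (0 : ℝ)..1, besselJ ν (r * u) * (1 - besselTail ν (R * u)) := by
  have hc := continuous_besselJ hν
  unfold hankelKernel
  rw [intervalIntegral_swap_of_continuous (by simp only [Function.uncurry_def]; fun_prop)]
  refine intervalIntegral.integral_congr_ae (ae_of_all _ fun u hu => ?_)
  rw [Set.uIoc_of_le zero_le_one] at hu
  have hu0 : 0 < u := hu.1
  rw [intervalIntegral.integral_const_mul, intervalIntegral.integral_comp_mul_right (besselJ ν)
    hu0.ne', integral_besselJ_eq hν, zero_mul, besselTail_zero, smul_eq_mul]
  field_simp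

theorem integral_orthogonalHankelKernel {ν : ℝ} (hν : 0 < ν) (r R : ℝ) :
    ∫ ρ in (0 : ℝ)..R, orthogonalHankelKernel ν r ρ
      = r * (∫ ρ in (0 : ℝ)..R, hankelKernel ν r ρ)
        + besselTail ν r * (1 - besselTail ν R) / 2 := by
  have hc := continuous_besselJ hν
  have hcK : Continuous fun ρ : ℝ => hankelKernel ν r ρ :=
    Continuous.hankelKernel hν (by fun_prop) (by fun_prop)
  unfold orthogonalHankelKernel
  rw [intervalIntegral.integral_add (Continuous.intervalIntegrable (by fun_prop) _ _)
    (Continuous.intervalIntegrable (by fun_prop) _ _), intervalIntegral.integral_const_mul,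
    intervalIntegral.integral_div, intervalIntegral.integral_mul_const, integral_besselJ_eq hν,
    besselTail_zero]
  ring

theorem integral_orthogonalHankelKernel_self {ν : ℝ} (hν : 0 < ν) (r : ℝ) :
    ∫ ρ in (0 : ℝ)..r, orthogonalHankelKernel ν r ρ = (1 - besselTail ν r) / 2 := by
  have hc := continuous_besselJ hν
  have hcG := continuous_besselTail hν
  have h1 : ∫ u in (0 : ℝ)..1, r * (besselJ ν (r * u) * (1 - besselTail ν (r * u)))
      = (1 - besselTail ν r) ^ 2 / 2 := by
    rw [intervalIntegral.integral_eq_sub_of_hasDerivAt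
      (f := fun u => (1 - besselTail ν (r * u)) ^ 2 / 2) (fun u _ => ?_)
      (Continuous.intervalIntegrable (by fun_prop) _ _)]
    · simp [besselTail_zero]
    · have d := (hasDerivAt_besselTail hν (r * u)).comp u ((hasDerivAt_id u).const_mul r)
      refine (((d.const_sub 1).pow 2).div_const 2).congr_deriv ?_
      simp only [Function.comp]
      push_cast; ring
  rw [integral_orthogonalHankelKernel hν, integral_hankelKernel_eq hν r r,
    ← intervalIntegral.integral_const_mul, h1]
  ring

/-- The integrals of the kernel over `[r, R]` are bounded in `R`. -/
theorem exists_abs_integral_orthogonalHankelKernel_le {ν : ℝ} (hν : 0 < ν) {r : ℝ} (hr : 0 < r) :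
    ∃ C, ∀ R, 0 ≤ R → |∫ ρ in r..R, orthogonalHankelKernel ν r ρ| ≤ C := by
  obtain ⟨A, hA, hbA⟩ := exists_besselJ_bound hν
  obtain ⟨D, hD, hbD⟩ := exists_besselTail_bound hν
  have hbD' : ∀ x, 0 ≤ x → |1 - besselTail ν x| ≤ 1 + D := fun x hx => by
    have := abs_sub 1 (besselTail ν x)
    rw [abs_one] at this
    linarith [(hbD x hx).1]
  have h0 : ∀ R, 0 ≤ R → |∫ ρ in (0 : ℝ)..R, orthogonalHankelKernel ν r ρ|
      ≤ r * (A * (1 + D)) + D * (1 + D) / 2 := by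
    intro R hR
    have h1 : ‖∫ u in (0 : ℝ)..1, besselJ ν (r * u) * (1 - besselTail ν (R * u))‖
        ≤ A * (1 + D) * |1 - 0| := by
      refine intervalIntegral.norm_integral_le_of_norm_le_const fun u hu => ?_
      rw [Set.uIoc_of_le zero_le_one] at hu
      rw [norm_mul]
      exact mul_le_mul (hbA _ (mul_nonneg hr.le hu.1.le)).1 (hbD' _ (mul_nonneg hR hu.1.le))
        (norm_nonneg _) hA.le
    rw [sub_zero, abs_one, mul_one, Real.norm_eq_abs, ← integral_hankelKernel_eq hν r R] at h1
    rw [integral_orthogonalHankelKernel hν]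
    refine (abs_add_le _ _).trans (add_le_add ?_ ?_)
    · rw [abs_mul, abs_of_pos hr]; gcongr
    · rw [abs_div, abs_mul, abs_of_pos (two_pos (α := ℝ))]
      gcongr
      · exact (hbD r hr.le).1
      · exact hbD' R hR
  have hi := fun a b => (continuous_orthogonalHankelKernel_right hν r).intervalIntegrable
    (μ := volume) a b
  refine ⟨2 * (r * (A * (1 + D)) + D * (1 + D) / 2), fun R hR => ?_⟩
  rw [← intervalIntegral.integral_interval_sub_left (hi 0 R) (hi 0 r)]
  linarith [abs_sub (∫ ρ in (0 : ℝ)..R, orthogonalHankelKernel ν r ρ)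
    (∫ ρ in (0 : ℝ)..r, orthogonalHankelKernel ν r ρ), h0 R hR, h0 r hr.le]

theorem tendsto_orthogonalHankelKernel_left {ν : ℝ} (hν : 0 < ν) {r : ℝ} (hr : 0 < r) :
    Tendsto (fun R => orthogonalHankelKernel ν R r) atTop (𝓝 0) := by
  obtain ⟨C, hC, hb⟩ := exists_hankelKernel_bound hν
  have h1 : Tendsto (fun R => R * hankelKernel ν R r) atTop (𝓝 0) := by
    refine squeeze_zero_norm' (a := fun R : ℝ => 2 * C / √r / √R) ?_
      (tendsto_const_nhds.div_atTop Real.tendsto_sqrt_atTop)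
    filter_upwards [eventually_ge_atTop (2 * r)] with R hR
    have hR0 : 0 < R := by linarith
    have h2 := (hb R r hR0 hr).2
    have hs : 0 < √R := Real.sqrt_pos.mpr hR0
    have hs' : 0 < √r := Real.sqrt_pos.mpr hr
    rw [abs_of_nonneg (by linarith)] at h2
    rw [norm_mul, Real.norm_of_nonneg hR0.le, Real.norm_eq_abs, le_div_iff₀ hs, le_div_iff₀ hs']
    have h3 : R * |hankelKernel ν R r| ≤ 2 * ((R - r) * |hankelKernel ν R r|) := by
      nlinarith [abs_nonneg (hankelKernel ν R r)]
    calc R * |hankelKernel ν R r| * √R * √r = √R * √r * (R * |hankelKernel ν R r|) := by ring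
      _ ≤ √R * √r * (2 * ((R - r) * |hankelKernel ν R r|)) := by gcongr
      _ ≤ 2 * C := by linarith
  have h2 := h1.add (((tendsto_besselTail hν).const_mul (besselJ ν r)).div_const 2)
  simpa [orthogonalHankelKernel] using h2

/-- The product is a combination of the three integrals evaluated above and of
`∫_0^∞ J_ν G = 1/2`, where `G` is `besselTail`. -/
theorem tendsto_integral_orthogonalHankelKernel_mul {ν : ℝ} (hν : 0 < ν) {r : ℝ} (hr : 0 < r) :
    Tendsto (fun R => ∫ ρ in (0 : ℝ)..R,
      orthogonalHankelKernel ν r ρ * orthogonalHankelKernel ν ρ r) atTop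
      (𝓝 (r * hankelKernel ν r r + 3 / 8 * (besselJ ν r * besselTail ν r))) := by
  have hc := continuous_besselJ hν
  have hcG := continuous_besselTail hν
  have hcK : Continuous fun ρ : ℝ => hankelKernel ν r ρ :=
    Continuous.hankelKernel hν (by fun_prop) (by fun_prop)
  have hJG : ∀ R, ∫ ρ in (0 : ℝ)..R, besselJ ν ρ * besselTail ν ρ
      = (1 - besselTail ν R ^ 2) / 2 := by
    intro R
    rw [intervalIntegral.integral_eq_sub_of_hasDerivAt
      (f := fun ρ => (1 - besselTail ν ρ ^ 2) / 2) (fun ρ _ => ?_)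
      (Continuous.intervalIntegrable (by fun_prop) _ _)]
    · simp [besselTail_zero]
    · refine ((((hasDerivAt_besselTail hν ρ).pow 2).const_sub 1).div_const 2).congr_deriv ?_
      push_cast; ring
  have h1 := (tendsto_integral_mul_sq_hankelKernel hν hr).const_mul r
  have h2 := (tendsto_integral_hankelKernel_mul_besselTail hν hr).const_mul (r * besselJ ν r / 2)
  have h3 := (tendsto_integral_hankelKernel_mul_besselJ hν hr).const_mul (besselTail ν r / 2)
  have h4 := ((((tendsto_besselTail hν).pow 2).const_sub 1).div_const 2).const_mul
    (besselJ ν r * besselTail ν r / 4)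
  have h := ((h1.add h2).add h3).add h4
  have hlim : r * hankelKernel ν r r + r * besselJ ν r / 2 * 0
      + besselTail ν r / 2 * (besselJ ν r / 2)
      + besselJ ν r * besselTail ν r / 4 * ((1 - 0 ^ 2) / 2)
      = r * hankelKernel ν r r + 3 / 8 * (besselJ ν r * besselTail ν r) := by ring
  rw [hlim] at h
  refine h.congr fun R => ?_
  rw [← hJG, ← intervalIntegral.integral_const_mul, ← intervalIntegral.integral_const_mul,
    ← intervalIntegral.integral_const_mul, ← intervalIntegral.integral_const_mul,
    ← intervalIntegral.integral_add (Continuous.intervalIntegrable (by fun_prop) _ _)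
    (Continuous.intervalIntegrable (by fun_prop) _ _),
    ← intervalIntegral.integral_add (Continuous.intervalIntegrable (by fun_prop) _ _)
    (Continuous.intervalIntegrable (by fun_prop) _ _),
    ← intervalIntegral.integral_add (Continuous.intervalIntegrable (by fun_prop) _ _)
    (Continuous.intervalIntegrable (by fun_prop) _ _)]
  congr 1; ext ρ
  unfold orthogonalHankelKernel
  rw [hankelKernel_comm ν ρ r]
  ring

/-- The determinant of the orthogonal Bessel kernel at `(r², ρ²)`, multiplied by `4rρ`.
The arguments of `orthogonalHankelDeriv` are interchanged, so that it is the derivative in `ρ` of the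
second factor of the product; its antisymmetry accounts for the sign. -/
noncomputable def orthogonalHankelDet (ν r ρ : ℝ) : ℝ :=
  orthogonalHankelKernel ν r ρ * orthogonalHankelKernel ν ρ r
    + (-(∫ t in r..ρ, orthogonalHankelKernel ν r t) - 1 / 2 * Real.sign (r - ρ))
      * orthogonalHankelDeriv ν ρ r

theorem intervalIntegrable_orthogonalHankelDet {ν : ℝ} (hν : 0 < ν) {r R : ℝ} (hr : 0 < r)
    (hR : r ≤ R) : IntervalIntegrable (orthogonalHankelDet ν r) volume 0 R := by
  have hA := continuous_orthogonalHankelKernel_right hν r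
  have hB := continuous_orthogonalHankelKernel_left hν r
  have hb : Continuous fun ρ => orthogonalHankelDeriv ν ρ r := by
    simp_rw [orthogonalHankelDeriv_swap ν r]
    exact (continuous_orthogonalHankelDeriv hν r).neg
  have hprim : Continuous fun ρ => ∫ t in r..ρ, orthogonalHankelKernel ν r t :=
    intervalIntegral.continuous_primitive (fun a b => hA.intervalIntegrable a b) r
  obtain ⟨i1, i2⟩ := intervalIntegrable_sign_mul hb hr.le hR
  have h1 : IntervalIntegrable (fun ρ => orthogonalHankelKernel ν r ρ * orthogonalHankelKernel ν ρ r
    - (∫ t in r..ρ, orthogonalHankelKernel ν r t) * orthogonalHankelDeriv ν ρ r) volume 0 R :=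
    Continuous.intervalIntegrable (by fun_prop) _ _
  have heq : orthogonalHankelDet ν r = fun ρ =>
      (orthogonalHankelKernel ν r ρ * orthogonalHankelKernel ν ρ r
        - (∫ t in r..ρ, orthogonalHankelKernel ν r t) * orthogonalHankelDeriv ν ρ r)
      - 1 / 2 * (Real.sign (r - ρ) * orthogonalHankelDeriv ν ρ r) := by
    ext ρ; unfold orthogonalHankelDet; ring
  rw [heq]
  exact h1.sub ((i1.trans i2).const_mul _)

theorem tendsto_integral_orthogonalHankelDet {ν : ℝ} (hν : 0 < ν) {r : ℝ} (hr : 0 < r) :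
    Tendsto (fun R => ∫ ρ in (0 : ℝ)..R, orthogonalHankelDet ν r ρ) atTop
      (𝓝 (orthogonalHankelKernel ν r r)) := by
  have hb : Continuous fun ρ => orthogonalHankelDeriv ν ρ r := by
    simp_rw [orthogonalHankelDeriv_swap ν r]
    exact (continuous_orthogonalHankelDeriv hν r).neg
  have hB := tendsto_orthogonalHankelKernel_left hν hr
  obtain ⟨C, hC⟩ := exists_abs_integral_orthogonalHankelKernel_le hν hr
  have h1 : Tendsto (fun R => (∫ t in r..R, orthogonalHankelKernel ν r t)
      * orthogonalHankelKernel ν R r) atTop (𝓝 0) :=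
    bdd_le_mul_tendsto_zero' C
      (by filter_upwards [eventually_ge_atTop 0] with R hR using hC R hR) hB
  have h0 : orthogonalHankelKernel ν 0 r = besselJ ν r / 2 := by
    simp [orthogonalHankelKernel, besselTail_zero]
  have h := (((((tendsto_integral_orthogonalHankelKernel_mul hν hr).const_mul 2).sub h1).sub_const
    ((1 - besselTail ν r) / 2 * (besselJ ν r / 2))).sub_const
      (orthogonalHankelKernel ν r r)).add_const (besselJ ν r / 2 / 2) |>.add (hB.div_const 2)
  -- The boundary terms complete twice the limit of the product term to the diagonal value.
  have hlim : 2 * (r * hankelKernel ν r r + 3 / 8 * (besselJ ν r * besselTail ν r)) - 0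
      - (1 - besselTail ν r) / 2 * (besselJ ν r / 2) - orthogonalHankelKernel ν r r
      + besselJ ν r / 2 / 2 + 0 / 2 = orthogonalHankelKernel ν r r := by
    unfold orthogonalHankelKernel; ring
  rw [hlim] at h
  refine h.congr' ?_
  filter_upwards [eventually_ge_atTop r] with R hR
  have := integral_mul_add_sign_mul (continuous_orthogonalHankelKernel_right hν r)
    (continuous_orthogonalHankelKernel_left hν r) hb
    (fun ρ hρ => hasDerivAt_orthogonalHankelKernel hν hρ hr) hr hR
  unfold orthogonalHankelDet
  rw [this, integral_orthogonalHankelKernel_self hν r, h0]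

/-! ### Return to the original variables -/

theorem hasImproperIntegral_besselJ {ν : ℝ} (hν : 0 < ν) (a : ℝ) :
    HasImproperIntegral (besselJ ν) a (besselTail ν a) := by
  have hc := continuous_besselJ hν
  refine ⟨fun b _ => (hc.intervalIntegrable a b).1, ?_⟩
  simp_rw [integral_besselJ_eq hν]
  simpa using (tendsto_besselTail hν).const_sub (besselTail ν a)

theorem HasImproperIntegral.improperIntegral_eq {f : ℝ → ℝ} {a L : ℝ}
    (h : HasImproperIntegral f a L) : improperIntegral f a = L :=
  h.2.limUnder_eq

theorem orthogonalBesselScalar_sq {s : ℝ} (hs : -1 < s) {r ρ : ℝ} (hr : 0 < r) (hρ : 0 < ρ) :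
    orthogonalBesselScalar s (r ^ 2) (ρ ^ 2) = orthogonalHankelKernel (s + 1) r ρ / (2 * ρ) := by
  have hν : 0 < s + 1 := by linarith
  unfold orthogonalBesselScalar orthogonalHankelKernel
  rw [besselKernel_sq hν hr hρ, Real.sqrt_sq hρ.le, Real.sqrt_sq hr.le,
    (hasImproperIntegral_besselJ hν r).improperIntegral_eq, ← div_pow,
    Real.sqrt_sq (by positivity)]
  field_simp
  ring

theorem orthogonalBesselScalar_eq {s : ℝ} (hs : -1 < s) {x y : ℝ} (hx : 0 < x) (hy : 0 < y) :
    orthogonalBesselScalar s x y = orthogonalHankelKernel (s + 1) (√x) (√y) / (2 * √y) := by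
  have h := orthogonalBesselScalar_sq hs (Real.sqrt_pos.mpr hx) (Real.sqrt_pos.mpr hy)
  rwa [Real.sq_sqrt hx.le, Real.sq_sqrt hy.le] at h

theorem deriv_orthogonalBesselScalar_sq {s : ℝ} (hs : -1 < s) {r ρ : ℝ} (hr : 0 < r)
    (hρ : 0 < ρ) :
    deriv (fun u => orthogonalBesselScalar s u (ρ ^ 2)) (r ^ 2)
      = orthogonalHankelDeriv (s + 1) r ρ / (4 * r * ρ) := by
  have hν : 0 < s + 1 := by linarith
  have hsq : √(r ^ 2) = r := Real.sqrt_sq hr.le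
  have hd : HasDerivAt (fun u => orthogonalHankelKernel (s + 1) u ρ)
      (orthogonalHankelDeriv (s + 1) r ρ) (√(r ^ 2)) := by
    rw [hsq]; exact hasDerivAt_orthogonalHankelKernel hν hr hρ
  have h1 := (hd.comp (r ^ 2) (Real.hasDerivAt_sqrt (by positivity))).div_const (2 * ρ)
  have heq : (fun u => orthogonalBesselScalar s u (ρ ^ 2)) =ᶠ[𝓝 (r ^ 2)]
      fun u => ((fun u => orthogonalHankelKernel (s + 1) u ρ) ∘ Real.sqrt) u / (2 * ρ) := by
    filter_upwards [lt_mem_nhds (show 0 < r ^ 2 by positivity)] with u hu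
    rw [orthogonalBesselScalar_eq hs hu (by positivity), Real.sqrt_sq hρ.le]
    rfl
  rw [(h1.congr_of_eventuallyEq heq).deriv, hsq]
  field_simp
  ring

theorem integral_orthogonalBesselScalar_sq {s : ℝ} (hs : -1 < s) {r ρ : ℝ} (hr : 0 < r)
    (hρ : 0 < ρ) :
    ∫ t in r ^ 2..ρ ^ 2, orthogonalBesselScalar s (r ^ 2) t
      = ∫ t in r..ρ, orthogonalHankelKernel (s + 1) r t := by
  have hν : 0 < s + 1 := by linarith
  have hA := continuous_orthogonalHankelKernel_right hν r
  have hpos : ∀ t ∈ Set.uIcc (r ^ 2) (ρ ^ 2), 0 < t := fun t ht =>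
    (lt_min (by positivity) (by positivity)).trans_le ht.1
  have h1 : ∫ t in r ^ 2..ρ ^ 2, orthogonalBesselScalar s (r ^ 2) t
      = ∫ t in r ^ 2..ρ ^ 2, orthogonalHankelKernel (s + 1) r (√t) * (1 / (2 * √t)) := by
    refine intervalIntegral.integral_congr fun t ht => ?_
    rw [orthogonalBesselScalar_eq hs (by positivity) (hpos t ht), Real.sqrt_sq hr.le,
      mul_one_div]
  rw [h1, intervalIntegral.integral_eq_sub_of_hasDerivAt
    (f := fun t => ∫ w in r..√t, orthogonalHankelKernel (s + 1) r w)]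
  · simp [Real.sqrt_sq hr.le, Real.sqrt_sq hρ.le]
  · exact fun t ht => ((hA.integral_hasStrictDerivAt r (√t)).hasDerivAt).comp t
      (Real.hasDerivAt_sqrt (hpos t ht).ne')
  · refine ContinuousOn.intervalIntegrable ?_
    refine (hA.comp Real.continuous_sqrt).continuousOn.mul (continuousOn_const.div
      (by fun_prop) fun t ht => ?_)
    have := Real.sqrt_pos.mpr (hpos t ht)
    positivity

theorem sign_sq_sub_sq {r ρ : ℝ} (hr : 0 < r) (hρ : 0 < ρ) :
    Real.sign (r ^ 2 - ρ ^ 2) = Real.sign (r - ρ) := by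
  have h : r ^ 2 - ρ ^ 2 = (r + ρ) * (r - ρ) := by ring
  have hp : 0 < r + ρ := by positivity
  rcases lt_trichotomy (r - ρ) 0 with h1 | h1 | h1
  · rw [Real.sign_of_neg h1, Real.sign_of_neg (by rw [h]; exact mul_neg_of_pos_of_neg hp h1)]
  · rw [h, h1, mul_zero]
  · rw [Real.sign_of_pos h1, Real.sign_of_pos (by rw [h]; exact mul_pos hp h1)]

theorem det_orthogonalBesselKernel_sq {s : ℝ} (hs : -1 < s) {r ρ : ℝ} (hr : 0 < r) (hρ : 0 < ρ) :
    2 * ρ * (orthogonalBesselKernel s (r ^ 2) (ρ ^ 2)).det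
      = orthogonalHankelDet (s + 1) r ρ / (2 * r) := by
  rw [orthogonalBesselKernel, Matrix.det_fin_two_of, orthogonalBesselScalar_sq hs hr hρ,
    orthogonalBesselScalar_sq hs hρ hr, deriv_orthogonalBesselScalar_sq hs hr hρ,
    integral_orthogonalBesselScalar_sq hs hr hρ, sign_sq_sub_sq hr hρ, orthogonalHankelDet,
    orthogonalHankelDeriv_swap (s + 1) r ρ]
  field_simp
  ring

theorem sq_image_Ioc {R : ℝ} (hR : 0 ≤ R) :
    (fun ρ : ℝ => ρ ^ 2) '' Set.Ioc 0 R = Set.Ioc 0 (R ^ 2) := by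
  ext y
  constructor
  · rintro ⟨ρ, hρ, rfl⟩
    exact ⟨pow_pos hρ.1 2, pow_le_pow_left₀ hρ.1.le hρ.2 2⟩
  · intro hy
    exact ⟨√y, ⟨Real.sqrt_pos.mpr hy.1, (Real.sqrt_le_left hR).mpr hy.2⟩, Real.sq_sqrt hy.1.le⟩

/-- The inner integral of the theorem has the value `K_{1,s}(x,x)`. -/
theorem hasImproperIntegral_det {s : ℝ} (hs : -1 < s) {x : ℝ} (hx : 0 < x) :
    HasImproperIntegral (fun y => (orthogonalBesselKernel s x y).det) 0
      (orthogonalBesselScalar s x x) := by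
  have hν : 0 < s + 1 := by linarith
  set r := √x with hrdef
  have hr : 0 < r := Real.sqrt_pos.mpr hx
  have hxr : x = r ^ 2 := (Real.sq_sqrt hx.le).symm
  have hcongr : ∀ R, Set.EqOn (fun ρ : ℝ => |2 * ρ| • (orthogonalBesselKernel s x (ρ ^ 2)).det)
      (fun ρ => orthogonalHankelDet (s + 1) r ρ / (2 * r)) (Set.Ioc 0 R) := by
    intro R ρ hρ
    have hρ0 : 0 < ρ := hρ.1
    simp only
    rw [abs_of_pos (by positivity), smul_eq_mul, hxr, det_orthogonalBesselKernel_sq hs hr hρ0]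
  have hderiv : ∀ R, ∀ ρ ∈ Set.Ioc 0 R, HasDerivWithinAt (fun ρ : ℝ => ρ ^ 2) (2 * ρ)
      (Set.Ioc 0 R) ρ := fun R ρ _ =>
    ((hasDerivAt_pow 2 ρ).congr_deriv (by simp)).hasDerivWithinAt
  have hinj : ∀ R : ℝ, Set.InjOn (fun ρ : ℝ => ρ ^ 2) (Set.Ioc 0 R) := fun R a ha b hb hab =>
    (pow_left_inj₀ ha.1.le hb.1.le two_ne_zero).mp hab
  refine ⟨fun b hb => ?_, ?_⟩
  · -- Integrability is known on `[0,R]` for `R ≥ r` only, hence the larger interval.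
    have hR : 0 ≤ r + √b := by positivity
    have h1 : IntegrableOn (fun y => (orthogonalBesselKernel s x y).det)
        (Set.Ioc 0 ((r + √b) ^ 2)) := by
      rw [← sq_image_Ioc hR, integrableOn_image_iff_integrableOn_abs_deriv_smul measurableSet_Ioc
        (hderiv _) (hinj _), integrableOn_congr_fun (hcongr _) measurableSet_Ioc]
      exact (intervalIntegrable_orthogonalHankelDet hν hr
        (le_add_of_nonneg_right (Real.sqrt_nonneg b))).1.div_const _
    refine h1.mono_set (Set.Ioc_subset_Ioc_right ?_)
    nlinarith [Real.sq_sqrt hb.le, Real.sqrt_nonneg b, mul_nonneg hr.le (Real.sqrt_nonneg b)]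
  · have h1 : ∀ b, 0 ≤ b → ∫ y in (0 : ℝ)..b, (orthogonalBesselKernel s x y).det
        = (∫ ρ in (0 : ℝ)..√b, orthogonalHankelDet (s + 1) r ρ) / (2 * r) := by
      intro b hb
      have hb' : Set.Ioc 0 b = (fun ρ : ℝ => ρ ^ 2) '' Set.Ioc 0 (√b) := by
        rw [sq_image_Ioc (Real.sqrt_nonneg b), Real.sq_sqrt hb]
      rw [intervalIntegral.integral_of_le hb, hb', integral_image_eq_integral_abs_deriv_smul
        measurableSet_Ioc (hderiv _) (hinj _), setIntegral_congr_fun measurableSet_Ioc (hcongr _),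
        integral_div, intervalIntegral.integral_of_le (Real.sqrt_nonneg b)]
    have h2 := ((tendsto_integral_orthogonalHankelDet hν hr).comp
      Real.tendsto_sqrt_atTop).div_const (2 * r)
    have h3 : orthogonalBesselScalar s x x = orthogonalHankelKernel (s + 1) r r / (2 * r) := by
      rw [hxr, orthogonalBesselScalar_sq hs hr hr]
    rw [h3]
    refine h2.congr' ?_
    filter_upwards [eventually_ge_atTop 0] with b hb using (h1 b hb).symm

theorem proposition2p13 (s : ℝ) (hs : -1 < s) :
    -- the improper integrals of `J_{s+1}` in the definition of the kernel converge
    (∀ a : ℝ, 0 ≤ a → ∃ L : ℝ, HasImproperIntegral (besselJ (s + 1)) a L) ∧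
    -- the inner integral converges for every `x > 0`
    (∀ x : ℝ, 0 < x →
      ∃ L : ℝ, HasImproperIntegral (fun y => (orthogonalBesselKernel s x y).det) 0 L) ∧
    -- the outer integral converges, and its value is `0`
    HasImproperIntegral
      (fun x => improperIntegral (fun y => (orthogonalBesselKernel s x y).det) 0
        - orthogonalBesselScalar s x x) 0 0 := by
  have hz : ∀ b : ℝ, Set.EqOn (fun x => improperIntegral
      (fun y => (orthogonalBesselKernel s x y).det) 0 - orthogonalBesselScalar s x x)
      (fun _ => 0) (Set.Ioc 0 b) := fun b x hx => by
    simp only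
    rw [(hasImproperIntegral_det hs hx.1).improperIntegral_eq, sub_self]
  refine ⟨fun a _ => ⟨_, hasImproperIntegral_besselJ (by linarith) a⟩,
    fun x hx => ⟨_, hasImproperIntegral_det hs hx⟩, fun b _ => ?_, ?_⟩
  · rw [integrableOn_congr_fun (hz b) measurableSet_Ioc]
    exact integrableOn_zero
  · refine tendsto_const_nhds.congr' ?_
    filter_upwards [eventually_ge_atTop 0] with b hb
    rw [intervalIntegral.integral_of_le hb, setIntegral_congr_fun measurableSet_Ioc (hz b)]
    simp
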